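/- Let $\rho(x,y)=(-x,y)$ on $\mathbb R^2$, with axis $\ell=\{0\}\times\mathbb R$. An oriented link diagram $D\subset\mathbb R^2$ is *symmetric* if $\rho(D)$ is obtained from $D$ by reversing the orientation and switching all the crossings on $\ell$. Diagrams are identified if an orientation-preserving diffeomorphism of $\mathbb R^2$ commuting with $\rho$ carries one to the other. A *symmetric Reidemeister move off the axis* is an ordinary Reidemeister move away from $\ell$ carried out together with its mirror image under $\rho$. The *symmetric Reidemeister moves on the axis* are the following local moves, performed inside a disc invariant under $\rho$, in all variants (any types of the crossings on $\ell$, over- and under-versions, upside down): - $S2(h)$: a second Reidemeister move between two arcs each crossing $\ell$ transversally, whose two crossings lie off $\ell$ and are exchanged by $\rho$; - $S2(\pm)$: a crossing on $\ell$ is turned by $\pi$ in space about the horizontal line through it, which removes (or creates) one crossing on each side of $\ell$ between its upper and lower end, and leaves the type of the crossing on $\ell$ unchanged; - $S3$: an arc that crosses $\ell$ transversally is moved over, or under, a crossing on $\ell$; - $S4$: two neighbouring crossings on $\ell$ exchange their places on $\ell$, one of them with its four strands passing over, or under, the other, which removes (or creates) the four crossings on each side of $\ell$ between the strands of one and the strands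 of the other. Two further moves are $S1(\pm)$, which removes or creates a kink in an arc crossing $\ell$, with the crossing of the kink on $\ell$, and $S2(v)$, which removes or creates two consecutive crossings of opposite types on $\ell$. Two oriented symmetric diagrams are *symmetrically equivalent* if they are related by a finite sequence of symmetric Reidemeister moves off and on the axis and $S1$-moves, and *weakly symmetrically equivalent* if $S2(v)$-moves are allowed in addition. For a symmetric diagram $D$ and $h\in\mathbb Z$, the diagram $D(h)$ is obtained by replacing each crossing on $\ell$ with $|h|$ consecutive crossings on $\ell$, all of the same type as the original one if $h>0$ and all of the opposite type if $h<0$; for $h=0$ the crossing is replaced with two arcs parallel to $\ell$, one on each side. If $h$ is odd, $D(h)$ inherits an orientation from $D$ and is then a symmetric diagram. If $h$ is even, the orientation of $D$ does not extend across the replaced crossings, and $D(h)$ is considered with any orientation making it a symmetric diagram. **Theorem.** Let $D$ and $D'$ be symmetrically equivalent (respectively, weakly symmetrically equivalent) oriented symmetric diagrams. Then for every $h\in\mathbb Z$ the diagrams $D(h)$ and $D'(h)$ are symmetrically equivalent (respectively, weakly symmetrically equivalent). More precisely: 1. both $D(h)$ and $D'(h)$ have orientations that make them symmetric diagrams, and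 for every such orientation of one of them there is such an orientation of the other for which the two are (weakly) symmetrically equivalent; 2. if $h$ is odd, they are (weakly) symmetrically equivalent with the orientations inherited from $D$ and $D'$. -/

import Mathlib

/-!
Symmetric link diagrams, presented by height-sliced words.

A diagram that is symmetric about the vertical axis `x = 0` is determined by its part in the closed
right half-plane, together with the type of every crossing on the axis.  We put that half in general
position for the height function `y` and record, from bottom to top, the sequence of its events.
Strands of the right half at a generic height are numbered `0, 1, 2, ...` from the axis outwards.
The mirror image of everything that happens off the axis is understood.

Two words present the same diagram, up to a diffeomorphism of the plane that preserves orientation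
and commutes with the reflection, exactly when they are related by the planar isotopy moves
`PlanarIsotopy` and the half-turn of the plane (`Event.halfTurn`).
-/

namespace SymUnion

/-- Events off the axis, in the right half-plane.  Labels in `α` carry orientations
(`α = Bool`), or nothing (`α = Unit`).  A crossing is `cross true` when its strand of positive
slope (lower left to upper right) is the over-strand, and `cross false` otherwise. -/
inductive OffEvent (α : Type) : Type
  | cup (d : α)
  | cap (d : α)
  | cross (s : Bool)

/-- Events on the axis: a non-crossing point of the axis at which the height of the diagram has a
local minimum or maximum (a symmetric curve crosses the axis horizontally), or a crossing on the
axis, with `cross true` when the strand of positive slope in the full plane is the over-strand. -/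
inductive AxisEvent (α : Type) : Type
  | min (d : α)
  | max (d : α)
  | cross (s : Bool)

/-- An event: `off g i` happens off the axis and its leftmost strand has number `i`. -/
inductive Event (α : Type) : Type
  | off (g : OffEvent α) (i : ℕ)
  | on (g : AxisEvent α)

/-- Words of events, read from bottom to top. -/
abbrev Word (α : Type) : Type := List (Event α)

/-- Forget the orientation of an event. -/
def Event.forget : Event Bool → Event Unit
  | .off (.cup _) i => .off (.cup ()) i
  | .off (.cap _) i => .off (.cap ()) i
  | .off (.cross s) i => .off (.cross s) i
  | .on (.min _) => .on (.min ())
  | .on (.max _) => .on (.max ())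
  | .on (.cross s) => .on (.cross s)

/-- The unoriented word underlying an oriented word. -/
def Word.forget (w : Word Bool) : Word Unit := w.map Event.forget

/-- `Passes e u v`: just below the event `e` the strands of the right half are oriented as in `u`,
just above it as in `v` (`true` is upwards, strands are listed from the axis outwards).  A cup or a
cap is labelled with the orientation of its left leg, a minimum or a maximum on the axis with that
of its leg in the right half.

The reflection carries the diagram to itself with the orientation reversed.  Hence at a crossing on
the axis the two right-hand ends are both incoming or both outgoing: the orientation of strand `0`
changes between upwards and downwards. -/
inductive Passes : Event Bool → List Bool → List Bool → Prop
  | cup (d : Bool) (l r : List Bool) :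
      Passes (.off (.cup d) l.length) (l ++ r) (l ++ d :: (!d) :: r)
  | cap (d : Bool) (l r : List Bool) :
      Passes (.off (.cap d) l.length) (l ++ d :: (!d) :: r) (l ++ r)
  | cross (s a b : Bool) (l r : List Bool) :
      Passes (.off (.cross s) l.length) (l ++ a :: b :: r) (l ++ b :: a :: r)
  | axisMin (d : Bool) (r : List Bool) : Passes (.on (.min d)) r (d :: r)
  | axisMax (d : Bool) (r : List Bool) : Passes (.on (.max d)) (d :: r) r
  | axisCross (s a : Bool) (r : List Bool) : Passes (.on (.cross s)) (a :: r) ((!a) :: r)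

/-- `Runs w u v`: the oriented word `w` is (half of) a symmetric tangle diagram whose strands in the
right half are oriented as in `u` at the bottom and as in `v` at the top. -/
inductive Runs : Word Bool → List Bool → List Bool → Prop
  | nil (u : List Bool) : Runs [] u u
  | cons {e : Event Bool} {w : Word Bool} {u v t : List Bool} :
      Passes e u v → Runs w v t → Runs (e :: w) u t

/-- An oriented symmetric link diagram. -/
structure SymDiagram : Type where
  word : Word Bool
  closed : Runs word [] []

/-! ### Identical diagrams -/

/-- The number of the leftmost strand that takes part in an event. -/
def Event.pos : Event Unit → ℕ
  | .off _ i => i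
  | .on _ => 0

/-- The number of strands of the right half that enter an event from below. -/
def Event.inn : Event Unit → ℕ
  | .off (.cup _) _ => 0
  | .off (.cap _) _ => 2
  | .off (.cross _) _ => 2
  | .on (.min _) => 0
  | .on (.max _) => 1
  | .on (.cross _) => 1

/-- The number of strands of the right half that leave an event at the top. -/
def Event.out : Event Unit → ℕ
  | .off (.cup _) _ => 2
  | .off (.cap _) _ => 0
  | .off (.cross _) _ => 2
  | .on (.min _) => 1
  | .on (.max _) => 0
  | .on (.cross _) => 1

/-- The elementary changes of a sliced diagram under a symmetric isotopy of the plane. -/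
inductive PlanarIsotopy : Word Unit → Word Unit → Prop
  /-- Two events in disjoint horizontal ranges exchange heights. -/
  | exchange (e : Event Unit) (g : OffEvent Unit) (k : ℕ) :
      PlanarIsotopy [e, .off g (e.pos + e.out + k)] [.off g (e.pos + e.inn + k), e]
  /-- A zigzag off the axis is straightened. -/
  | zigzag_left (i : ℕ) : PlanarIsotopy [.off (.cup ()) i, .off (.cap ()) (i + 1)] []
  | zigzag_right (i : ℕ) : PlanarIsotopy [.off (.cup ()) (i + 1), .off (.cap ()) i] []
  /-- A crossing off the axis slides through a minimum or a maximum of one of its strands. -/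
  | slide_cup (i : ℕ) (s : Bool) :
      PlanarIsotopy [.off (.cup ()) (i + 1), .off (.cross s) i]
        [.off (.cup ()) i, .off (.cross (!s)) (i + 1)]
  | slide_cap (i : ℕ) (s : Bool) :
      PlanarIsotopy [.off (.cross s) i, .off (.cap ()) (i + 1)]
        [.off (.cross (!s)) (i + 1), .off (.cap ()) i]
  /-- A maximum on the axis becomes a minimum on the axis between two symmetric maxima. -/
  | fork_max : PlanarIsotopy [.on (.max ())] [.on (.min ()), .off (.cap ()) 0]
  /-- A minimum on the axis becomes a maximum on the axis between two symmetric minima. -/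
  | fork_min : PlanarIsotopy [.on (.min ())] [.off (.cup ()) 0, .on (.max ())]

/-- The effect on an event of the half-turn `(x, y) ↦ (-x, -y)` of the plane.  The right half of the
turned diagram is the turned left half of the diagram, that is the right half reflected in
a horizontal line, with unchanged over-strands and with reversed orientation. -/
def Event.halfTurn : Event Bool → Event Bool
  | .off (.cup d) i => .off (.cap d) i
  | .off (.cap d) i => .off (.cup d) i
  | .off (.cross s) i => .off (.cross (!s)) i
  | .on (.min d) => .on (.max d)
  | .on (.max d) => .on (.min d)
  | .on (.cross s) => .on (.cross s)

/-- The half-turn of a diagram. -/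
def IsHalfTurn (D E : SymDiagram) : Prop := E.word = (D.word.map Event.halfTurn).reverse

/-! ### Symmetric Reidemeister moves -/

/-- Symmetric Reidemeister moves off the axis: ordinary Reidemeister moves in the right half-plane,
carried out together with their mirror images. -/
inductive OffAxisMove : Word Unit → Word Unit → Prop
  | r1_right (i : ℕ) (s : Bool) :
      OffAxisMove [.off (.cup ()) (i + 1), .off (.cross s) i, .off (.cap ()) (i + 1)] []
  | r1_left (i : ℕ) (s : Bool) :
      OffAxisMove [.off (.cup ()) i, .off (.cross s) (i + 1), .off (.cap ()) i] []
  | r2 (i : ℕ) (s : Bool) : OffAxisMove [.off (.cross s) i, .off (.cross (!s)) i] []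
  /-- The condition says that the three strands lie one above the other. -/
  | r3 (i : ℕ) (a b c : Bool) (h : b = a ∨ b = c) :
      OffAxisMove
        [.off (.cross a) i, .off (.cross b) (i + 1), .off (.cross c) i]
        [.off (.cross c) (i + 1), .off (.cross b) i, .off (.cross a) (i + 1)]

/-- Symmetric Reidemeister moves on the axis.  The Booleans `m`, `n` are the types of the crossings
on the axis, and `s` says which strands are over at the crossings off the axis; all choices, and the
pictures turned upside down, are admitted. -/
inductive AxisMove : Word Unit → Word Unit → Prop
  /-- S2(h): a second Reidemeister move between two arcs that cross the axis, with its two crossings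
  off the axis. -/
  | s2h (s : Bool) :
      AxisMove [.on (.min ()), .off (.cross s) 0, .on (.max ())] [.on (.max ()), .on (.min ())]
  /-- S2(±): a crossing on the axis makes a half-turn in space about the horizontal line through it.
  Before the turn its upper and its lower end cross once on the right, and symmetrically on the left;
  after it they do not cross. -/
  | s2 (s n : Bool) :
      AxisMove [.off (.cup ()) 0, .off (.cross s) 1, .on (.cross n), .off (.cap ()) 0]
        [.on (.cross n)]
  /-- S3: an arc that crosses the axis passes over or under a crossing on the axis. -/
  | s3_min (s n : Bool) :
      AxisMove [.on (.min ()), .off (.cross s) 0, .on (.cross n)]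
        [.on (.cross n), .on (.min ()), .off (.cross s) 0]
  | s3_max (s n : Bool) :
      AxisMove [.on (.cross n), .off (.cross s) 0, .on (.max ())]
        [.off (.cross s) 0, .on (.max ()), .on (.cross n)]
  /-- S4: two crossings on the axis exchange their places, one of them passing over or under the other
  together with its four strands. -/
  | s4 (s m n : Bool) :
      AxisMove
        [.off (.cup ()) 0, .on (.cross n),
          .off (.cross s) 1, .off (.cross s) 0, .off (.cross s) 2, .off (.cross s) 1,
          .on (.cross m), .off (.cap ()) 0]
        [.on (.cross m), .off (.cap ()) 0, .off (.cup ()) 0, .on (.cross n)]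

/-- S1(±): a kink whose crossing lies on the axis. -/
inductive S1Move : Word Unit → Word Unit → Prop
  | above (n : Bool) : S1Move [.on (.cross n), .on (.max ())] [.on (.max ())]
  | below (n : Bool) : S1Move [.on (.min ()), .on (.cross n)] [.on (.min ())]

/-- S2(v): a second Reidemeister move with both crossings on the axis. -/
inductive S2vMove : Word Unit → Word Unit → Prop
  | mk (n : Bool) : S2vMove [.on (.cross n), .on (.cross (!n))] []

/-- The oriented diagrams `D` and `E` agree outside a region symmetric about the axis, with the same
orientations of all strands on the boundary of that region, and inside it they differ by `M`. -/
def Local (M : Word Unit → Word Unit → Prop) (D E : SymDiagram) : Prop :=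
  ∃ (p a b q : Word Bool) (u v : List Bool),
    D.word = p ++ a ++ q ∧ E.word = p ++ b ++ q ∧ M a.forget b.forget ∧
      Runs p [] u ∧ Runs a u v ∧ Runs b u v ∧ Runs q v []

/-- An elementary step of symmetric equivalence. -/
def SymStep (D E : SymDiagram) : Prop :=
  Local PlanarIsotopy D E ∨ IsHalfTurn D E ∨ Local OffAxisMove D E ∨ Local AxisMove D E ∨
    Local S1Move D E

/-- Symmetric equivalence of oriented symmetric diagrams. -/
def SymEquiv : SymDiagram → SymDiagram → Prop := Relation.EqvGen SymStep

/-- Weak symmetric equivalence of oriented symmetric diagrams. -/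
def WeakSymEquiv : SymDiagram → SymDiagram → Prop :=
  Relation.EqvGen fun D E => SymStep D E ∨ Local S2vMove D E

/-! ### The diagrams `D(h)` -/

/-- A crossing on the axis is replaced with `|h|` consecutive crossings on the axis, of the same type
if `h > 0` and of the opposite type if `h < 0`.  For `h = 0` two arcs parallel to the axis remain. -/
def Event.twist {α : Type} (h : ℤ) : Event α → Word α
  | .off g i => [.off g i]
  | .on (.min d) => [.on (.min d)]
  | .on (.max d) => [.on (.max d)]
  | .on (.cross s) => List.replicate h.natAbs (.on (.cross (if 0 ≤ h then s else !s)))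

/-- Replace every crossing on the axis. -/
def Word.twist {α : Type} (h : ℤ) (w : Word α) : Word α := w.flatMap (Event.twist h)

/-- `E` is the diagram `D(h)`, with some orientation that makes it an oriented symmetric diagram.
(For even `h` the two right-hand ends of a crossing on the axis become joined by an arc, so
`D(h)` cannot inherit the orientation of `D`.) -/
def IsTwist (h : ℤ) (D E : SymDiagram) : Prop := E.word.forget = Word.twist h D.word.forget

theorem Runs.append {w z : Word Bool} {u v t : List Bool} (hw : Runs w u v) (hz : Runs z v t) :
    Runs (w ++ z) u t := by
  induction hw with
  | nil => exact hz
  | cons he _ ih => exact Runs.cons he (ih hz)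

theorem Runs.replicate_axisCross (s a : Bool) (r : List Bool) (k : ℕ) :
    Runs (List.replicate (2 * k + 1) (.on (.cross s))) (a :: r) ((!a) :: r) := by
  induction k with
  | zero => exact Runs.cons (Passes.axisCross s a r) (Runs.nil _)
  | succ k ih =>
    have h2 : Runs [.on (.cross s), .on (.cross s)] ((!a) :: r) ((!a) :: r) := by
      refine Runs.cons (Passes.axisCross s (!a) r) (Runs.cons (v := (!a) :: r) ?_ (Runs.nil _))
      simpa using Passes.axisCross s (!(!a)) r
    have h3 := ih.append h2
    have h4 : List.replicate (2 * k + 1) (Event.on (AxisEvent.cross s) : Event Bool) ++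
        [.on (.cross s), .on (.cross s)] = List.replicate (2 * (k + 1) + 1) (.on (.cross s)) := by
      rw [show 2 * (k + 1) + 1 = (2 * k + 1) + 2 by ring, List.replicate_add (2 * k + 1) 2]
      rfl
    rwa [h4] at h3

theorem Passes.twist {h : ℤ} (hh : Odd h) {e : Event Bool} {u v : List Bool} (he : Passes e u v) :
    Runs (e.twist h) u v := by
  obtain ⟨k, hk⟩ := Int.natAbs_odd.mpr hh
  cases he with
  | cup d l r => exact Runs.cons (Passes.cup d l r) (Runs.nil _)
  | cap d l r => exact Runs.cons (Passes.cap d l r) (Runs.nil _)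
  | cross s a b l r => exact Runs.cons (Passes.cross s a b l r) (Runs.nil _)
  | axisMin d r => exact Runs.cons (Passes.axisMin d _) (Runs.nil _)
  | axisMax d r => exact Runs.cons (Passes.axisMax d _) (Runs.nil _)
  | axisCross s a r =>
    simp only [Event.twist, hk]
    exact Runs.replicate_axisCross _ a r k

theorem Runs.twist {h : ℤ} (hh : Odd h) {w : Word Bool} {u v : List Bool} (hw : Runs w u v) :
    Runs (Word.twist h w) u v := by
  induction hw with
  | nil u => exact Runs.nil u
  | cons he _ ih =>
    simp only [Word.twist, List.flatMap_cons]
    exact (he.twist hh).append ih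

/-- For odd `h`, the diagram `D(h)` with the orientation inherited from `D`. -/
def SymDiagram.oddTwist (h : ℤ) (hh : Odd h) (D : SymDiagram) : SymDiagram where
  word := Word.twist h D.word
  closed := D.closed.twist hh

/-- For the relation `R` on oriented symmetric diagrams: `D(h)` and `E(h)` are related.
Both carry orientations that make them symmetric diagrams; every such orientation of either one
is matched by such an orientation of the other for which they are related; and when `h` is odd
they are related with the orientations inherited from `D` and `E`. -/
def TwistsRelated (R : SymDiagram → SymDiagram → Prop) (h : ℤ) (D E : SymDiagram) : Prop :=
  (∃ D₁, IsTwist h D D₁) ∧ (∃ E₁, IsTwist h E E₁) ∧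
  (∀ D₁, IsTwist h D D₁ → ∃ E₁, IsTwist h E E₁ ∧ R D₁ E₁) ∧
  (∀ E₁, IsTwist h E E₁ → ∃ D₁, IsTwist h D D₁ ∧ R D₁ E₁) ∧
  (∀ hh : Odd h, R (D.oddTwist h hh) (E.oddTwist h hh))

end SymUnion

namespace SymUnion

/-! ### Orientations of unoriented tangle words -/

theorem Passes.off_cup_iff {d : Bool} {i : ℕ} {u v : List Bool} :
    Passes (.off (.cup d) i) u v ↔
      ∃ l r, l.length = i ∧ u = l ++ r ∧ v = l ++ d :: (!d) :: r := by
  constructor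
  · rintro ⟨⟩
    exact ⟨_, _, rfl, rfl, rfl⟩
  · rintro ⟨l, r, rfl, rfl, rfl⟩
    exact .cup d l r

theorem Passes.off_cap_iff {d : Bool} {i : ℕ} {u v : List Bool} :
    Passes (.off (.cap d) i) u v ↔
      ∃ l r, l.length = i ∧ u = l ++ d :: (!d) :: r ∧ v = l ++ r := by
  constructor
  · rintro ⟨⟩
    exact ⟨_, _, rfl, rfl, rfl⟩
  · rintro ⟨l, r, rfl, rfl, rfl⟩
    exact .cap d l r

theorem Passes.off_cross_iff {s : Bool} {i : ℕ} {u v : List Bool} :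
    Passes (.off (.cross s) i) u v ↔
      ∃ l r a b, l.length = i ∧ u = l ++ a :: b :: r ∧ v = l ++ b :: a :: r := by
  constructor
  · rintro ⟨⟩
    exact ⟨_, _, _, _, rfl, rfl, rfl⟩
  · rintro ⟨l, r, a, b, rfl, rfl, rfl⟩
    exact .cross s a b l r

theorem Passes.on_min_iff {d : Bool} {u v : List Bool} :
    Passes (.on (.min d)) u v ↔ v = d :: u :=
  ⟨by rintro ⟨⟩; rfl, by rintro rfl; exact .axisMin d u⟩

theorem Passes.on_max_iff {d : Bool} {u v : List Bool} :
    Passes (.on (.max d)) u v ↔ u = d :: v :=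
  ⟨by rintro ⟨⟩; rfl, by rintro rfl; exact .axisMax d v⟩

theorem Passes.on_cross_iff {s : Bool} {u v : List Bool} :
    Passes (.on (.cross s)) u v ↔ ∃ a r, u = a :: r ∧ v = (!a) :: r :=
  ⟨by rintro ⟨⟩; exact ⟨_, _, rfl, rfl⟩, by rintro ⟨a, r, rfl, rfl⟩; exact .axisCross s a r⟩

theorem Passes.off_succ_iff {g : OffEvent Bool} {i : ℕ} {u v : List Bool} :
    Passes (.off g (i + 1)) u v ↔
      ∃ a u' v', u = a :: u' ∧ v = a :: v' ∧ Passes (.off g i) u' v' := by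
  cases g with
  | cup d =>
    simp only [Passes.off_cup_iff]
    constructor
    · rintro ⟨_ | ⟨a, l⟩, r, hl, rfl, rfl⟩
      · simp at hl
      · exact ⟨a, _, _, rfl, rfl, l, r, by simpa using hl, rfl, rfl⟩
    · rintro ⟨a, _, _, rfl, rfl, l, r, rfl, rfl, rfl⟩
      exact ⟨a :: l, r, rfl, rfl, rfl⟩
  | cap d =>
    simp only [Passes.off_cap_iff]
    constructor
    · rintro ⟨_ | ⟨a, l⟩, r, hl, rfl, rfl⟩
      · simp at hl
      · exact ⟨a, _, _, rfl, rfl, l, r, by simpa using hl, rfl, rfl⟩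
    · rintro ⟨a, _, _, rfl, rfl, l, r, rfl, rfl, rfl⟩
      exact ⟨a :: l, r, rfl, rfl, rfl⟩
  | cross s =>
    simp only [Passes.off_cross_iff]
    constructor
    · rintro ⟨_ | ⟨a, l⟩, r, x, y, hl, rfl, rfl⟩
      · simp at hl
      · exact ⟨a, _, _, rfl, rfl, l, r, x, y, by simpa using hl, rfl, rfl⟩
    · rintro ⟨a, _, _, rfl, rfl, l, r, x, y, rfl, rfl, rfl⟩
      exact ⟨a :: l, r, x, y, rfl, rfl, rfl⟩

theorem Runs.nil_iff {u v : List Bool} : Runs [] u v ↔ u = v :=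
  ⟨by rintro ⟨⟩; rfl, by rintro rfl; exact .nil u⟩

theorem Runs.cons_iff {e : Event Bool} {w : Word Bool} {u v : List Bool} :
    Runs (e :: w) u v ↔ ∃ t, Passes e u t ∧ Runs w t v :=
  ⟨by rintro (_ | ⟨he, hw⟩); exact ⟨_, he, hw⟩, by rintro ⟨t, he, hw⟩; exact .cons he hw⟩

theorem Runs.append_iff {w z : Word Bool} {u v : List Bool} :
    Runs (w ++ z) u v ↔ ∃ t, Runs w u t ∧ Runs z t v := by
  induction w generalizing u with
  | nil => simp [Runs.nil_iff]
  | cons e w ih =>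
    simp only [List.cons_append, Runs.cons_iff, ih]
    constructor
    · rintro ⟨t, he, s, hw, hz⟩
      exact ⟨s, ⟨t, he, hw⟩, hz⟩
    · rintro ⟨s, ⟨t, he, hw⟩, hz⟩
      exact ⟨t, he, s, hw, hz⟩

/-- Some orientation of the event `e` passes from `u` to `v`. -/
def Event.Admits (e : Event Unit) (u v : List Bool) : Prop :=
  ∃ e' : Event Bool, e'.forget = e ∧ Passes e' u v

/-- Some orientation of the word `w` runs from `u` to `v`. -/
def Word.Admits (w : Word Unit) (u v : List Bool) : Prop :=
  ∃ w' : Word Bool, w'.forget = w ∧ Runs w' u v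

/-- Forgetting is defined on events only; the position `0` is a dummy that lets it be applied to
`g'` alone. -/
theorem Event.forget_eq_off_iff {e : Event Bool} {g : OffEvent Unit} {i : ℕ} :
    e.forget = .off g i ↔ ∃ g', e = .off g' i ∧ Event.forget (.off g' 0) = .off g 0 := by
  rcases e with ⟨_ | _ | _, j⟩ | _ | _ | _ <;> simp [Event.forget, eq_comm, and_comm]

/-- The strand next to the axis is idle. Peeling off idle strands reduces every event off the axis
to position `0`, where the lemmas below describe it completely. -/
theorem Event.admits_off_succ {g : OffEvent Unit} {i : ℕ} {u v : List Bool} :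
    Event.Admits (.off g (i + 1)) u v ↔
      ∃ a u' v', u = a :: u' ∧ v = a :: v' ∧ Event.Admits (.off g i) u' v' := by
  constructor
  · rintro ⟨_, hf, h⟩
    obtain ⟨g', rfl, hg⟩ := Event.forget_eq_off_iff.mp hf
    obtain ⟨a, u', v', rfl, rfl, h'⟩ := Passes.off_succ_iff.mp h
    exact ⟨a, u', v', rfl, rfl, _, Event.forget_eq_off_iff.mpr ⟨g', rfl, hg⟩, h'⟩
  · rintro ⟨a, u', v', rfl, rfl, _, hf, h⟩
    obtain ⟨g', rfl, hg⟩ := Event.forget_eq_off_iff.mp hf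
    exact ⟨_, Event.forget_eq_off_iff.mpr ⟨g', rfl, hg⟩,
      Passes.off_succ_iff.mpr ⟨a, u', v', rfl, rfl, h⟩⟩

theorem Event.admits_cup {u v : List Bool} :
    Event.Admits (.off (.cup ()) 0) u v ↔ ∃ d, v = d :: (!d) :: u := by
  constructor
  · rintro ⟨⟨_ | _ | _, j⟩ | _ | _ | _, h, hp⟩ <;> simp [Event.forget] at h
    subst h
    obtain ⟨l, r, hl, rfl, rfl⟩ := Passes.off_cup_iff.mp hp
    obtain rfl := List.length_eq_zero_iff.mp hl
    exact ⟨_, rfl⟩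
  · rintro ⟨d, rfl⟩
    exact ⟨.off (.cup d) 0, rfl, .cup d [] u⟩

theorem Event.admits_cap {u v : List Bool} :
    Event.Admits (.off (.cap ()) 0) u v ↔ ∃ d, u = d :: (!d) :: v := by
  constructor
  · rintro ⟨⟨_ | _ | _, j⟩ | _ | _ | _, h, hp⟩ <;> simp [Event.forget] at h
    subst h
    obtain ⟨l, r, hl, rfl, rfl⟩ := Passes.off_cap_iff.mp hp
    obtain rfl := List.length_eq_zero_iff.mp hl
    exact ⟨_, rfl⟩
  · rintro ⟨d, rfl⟩
    exact ⟨.off (.cap d) 0, rfl, .cap d [] v⟩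

theorem Event.admits_cross {s : Bool} {u v : List Bool} :
    Event.Admits (.off (.cross s) 0) u v ↔ ∃ a b r, u = a :: b :: r ∧ v = b :: a :: r := by
  constructor
  · rintro ⟨⟨_ | _ | _, j⟩ | _ | _ | _, h, hp⟩ <;> simp [Event.forget] at h
    obtain ⟨rfl, rfl⟩ := h
    obtain ⟨l, r, a, b, hl, rfl, rfl⟩ := Passes.off_cross_iff.mp hp
    obtain rfl := List.length_eq_zero_iff.mp hl
    exact ⟨_, _, _, rfl, rfl⟩
  · rintro ⟨a, b, r, rfl, rfl⟩
    exact ⟨.off (.cross s) 0, rfl, .cross s a b [] r⟩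

theorem Event.admits_min {u v : List Bool} :
    Event.Admits (.on (.min ())) u v ↔ ∃ d, v = d :: u := by
  constructor
  · rintro ⟨⟨_ | _ | _, j⟩ | _ | _ | _, h, hp⟩ <;> simp [Event.forget] at h
    exact ⟨_, Passes.on_min_iff.mp hp⟩
  · rintro ⟨d, rfl⟩
    exact ⟨.on (.min d), rfl, .axisMin d u⟩

theorem Event.admits_max {u v : List Bool} :
    Event.Admits (.on (.max ())) u v ↔ ∃ d, u = d :: v := by
  constructor
  · rintro ⟨⟨_ | _ | _, j⟩ | _ | _ | _, h, hp⟩ <;> simp [Event.forget] at h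
    exact ⟨_, Passes.on_max_iff.mp hp⟩
  · rintro ⟨d, rfl⟩
    exact ⟨.on (.max d), rfl, .axisMax d v⟩

theorem Event.admits_axisCross {s : Bool} {u v : List Bool} :
    Event.Admits (.on (.cross s)) u v ↔ ∃ a r, u = a :: r ∧ v = (!a) :: r := by
  constructor
  · rintro ⟨⟨_ | _ | _, j⟩ | _ | _ | _, h, hp⟩ <;> simp [Event.forget] at h
    exact Passes.on_cross_iff.mp hp
  · rintro ⟨a, r, rfl, rfl⟩
    exact ⟨.on (.cross s), rfl, .axisCross s a r⟩

theorem Word.admits_nil {u v : List Bool} : Word.Admits [] u v ↔ u = v := by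
  simp [Word.Admits, Word.forget, Runs.nil_iff]

theorem Word.admits_cons {e : Event Unit} {w : Word Unit} {u v : List Bool} :
    Word.Admits (e :: w) u v ↔ ∃ t, e.Admits u t ∧ Word.Admits w t v := by
  constructor
  · rintro ⟨_ | ⟨e', w'⟩, h, hr⟩
    · simp [Word.forget] at h
    · obtain ⟨rfl, rfl⟩ := List.cons.inj h
      obtain ⟨t, he, hw⟩ := Runs.cons_iff.mp hr
      exact ⟨t, ⟨e', rfl, he⟩, w', rfl, hw⟩
  · rintro ⟨t, ⟨e', rfl, he⟩, w', rfl, hw⟩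
    exact ⟨e' :: w', rfl, .cons he hw⟩

/-! ### Numbers of strands -/

/-- The number of strands above an event with `n` strands below it. -/
def Event.top : Event Unit → ℕ → ℕ
  | .off (.cup _) _, n => n + 2
  | .off (.cap _) _, n => n - 2
  | .off (.cross _) _, n => n
  | .on (.min _), n => n + 1
  | .on (.max _), n => n - 1
  | .on (.cross _), n => n

/-- The number of strands above a word with `n` strands below it. -/
def Word.top : Word Unit → ℕ → ℕ
  | [], n => n
  | e :: w, n => Word.top w (e.top n)

theorem Word.top_append (w z : Word Unit) (n : ℕ) :
    Word.top (w ++ z) n = Word.top z (Word.top w n) := by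
  induction w generalizing n with
  | nil => rfl
  | cons e w ih => exact ih _

theorem Word.top_replicate_axisCross (s : Bool) (k n : ℕ) :
    Word.top (List.replicate k (.on (.cross s))) n = n := by
  induction k with
  | zero => rfl
  | succ k ih => exact ih

/-- The truncated subtractions in `Event.top` do no harm, since an event that passes finds the
strands it removes. -/
theorem Passes.length_eq {e : Event Bool} {u v : List Bool} (h : Passes e u v) :
    v.length = e.forget.top u.length := by
  cases h <;> simp [Event.forget, Event.top] <;> omega

theorem Runs.length_eq {w : Word Bool} {u v : List Bool} (h : Runs w u v) :
    v.length = Word.top w.forget u.length := by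
  induction h with
  | nil => rfl
  | cons he _ ih => simpa [Word.forget, Word.top, he.length_eq] using ih

theorem Passes.pos_add_inn_le {e : Event Bool} {u v : List Bool} (h : Passes e u v) :
    e.forget.pos + e.forget.inn ≤ u.length := by
  cases h <;> simp [Event.forget, Event.pos, Event.inn]

/-! ### Pairs of words that admit the same boundary orientations -/

/-- With `n` strands at the bottom, `a` and `b` admit orientations for the same boundaries. -/
def Balanced (n : ℕ) (a b : Word Unit) : Prop :=
  ∀ u v : List Bool, u.length = n → (a.Admits u v ↔ b.Admits u v)

/-- Move an event off the axis one strand to the right. -/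
def Event.shift : Event Unit → Event Unit
  | .off g i => .off g (i + 1)
  | .on g => .on g

/-- All events of the word are off the axis. -/
def Word.OffAxis (w : Word Unit) : Prop := ∀ e ∈ w, ∃ g i, e = .off g i

/-- Shifting inserts an idle strand next to the axis, which keeps its orientation `a` throughout. -/
theorem Word.admits_shift {w : Word Unit} (hw : w.OffAxis) {a : Bool} {u v : List Bool} :
    Word.Admits (w.map Event.shift) (a :: u) v ↔ ∃ v', v = a :: v' ∧ w.Admits u v' := by
  induction w generalizing u with
  | nil => simp [Word.admits_nil, eq_comm]
  | cons e w ih =>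
    obtain ⟨g, i, rfl⟩ := hw e (by simp)
    have hw' : Word.OffAxis w := fun e he => hw e (by simp [he])
    simp only [List.map_cons, Word.admits_cons, Event.shift, Event.admits_off_succ]
    constructor
    · rintro ⟨_, ⟨_, _, t, ⟨rfl, rfl⟩, rfl, h1⟩, h2⟩
      obtain ⟨v', rfl, h3⟩ := (ih hw').mp h2
      exact ⟨v', rfl, t, h1, h3⟩
    · rintro ⟨v', rfl, t, h1, h2⟩
      exact ⟨a :: t, ⟨a, u, t, rfl, rfl, h1⟩, (ih hw').mpr ⟨v', rfl, h2⟩⟩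

theorem Word.not_admits_shift_nil {w : Word Unit} (hw : w.OffAxis) (hne : w ≠ [])
    (v : List Bool) : ¬ Word.Admits (w.map Event.shift) [] v := by
  cases w with
  | nil => exact absurd rfl hne
  | cons e w =>
    obtain ⟨g, i, rfl⟩ := hw e (by simp)
    simp [Word.admits_cons, Event.shift, Event.admits_off_succ]

theorem Balanced.shift {n : ℕ} {a b : Word Unit} (ha : a.OffAxis) (hb : b.OffAxis)
    (h : Balanced n a b) : Balanced (n + 1) (a.map Event.shift) (b.map Event.shift) := by
  rintro (_ | ⟨x, u⟩) v hu
  · simp at hu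
  · rw [Word.admits_shift ha, Word.admits_shift hb]
    simp only [h u _ (by simpa using hu)]

theorem Balanced.shift_zero {a b : Word Unit} (ha : a.OffAxis) (hb : b.OffAxis)
    (ha' : a ≠ []) (hb' : b ≠ []) :
    Balanced 0 (a.map Event.shift) (b.map Event.shift) := by
  rintro u v hu
  obtain rfl := List.length_eq_zero_iff.mp hu
  simp [Word.not_admits_shift_nil, *]

/-- Reduces a move off the axis to position `0`. Neither side may be empty: without any strand a
shifted non-empty word admits nothing, whereas the empty word still admits the empty boundary. -/
theorem Balanced.iterate_shift {a b : ℕ → Word Unit}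
    (ha : ∀ i, (a i).OffAxis) (hb : ∀ i, (b i).OffAxis)
    (ha' : ∀ i, a i ≠ []) (hb' : ∀ i, b i ≠ [])
    (ha₁ : ∀ i, a (i + 1) = (a i).map Event.shift) (hb₁ : ∀ i, b (i + 1) = (b i).map Event.shift)
    (h : ∀ n, Balanced n (a 0) (b 0)) (i n : ℕ) : Balanced n (a i) (b i) := by
  induction i generalizing n with
  | zero => exact h n
  | succ i ih =>
    rw [ha₁, hb₁]
    cases n with
    | zero => exact Balanced.shift_zero (ha i) (hb i) (ha' i) (hb' i)
    | succ n => exact (ih n).shift (ha i) (hb i)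

/-- The empty word runs on any number of strands, so a lower bound on `n` has to guarantee that the
other side has room. -/
theorem Balanced.iterate_shift_nil {a : ℕ → Word Unit} {k : ℕ} (ha : ∀ i, (a i).OffAxis)
    (ha₁ : ∀ i, a (i + 1) = (a i).map Event.shift) (h : ∀ n, k ≤ n → Balanced n (a 0) [])
    (i n : ℕ) (hn : i + k ≤ n) : Balanced n (a i) [] := by
  induction i generalizing n with
  | zero => exact h n (by omega)
  | succ i ih =>
    rw [ha₁]
    cases n with
    | zero => omega
    | succ n => exact (ih n (by omega)).shift (b := []) (ha i) (by simp [Word.OffAxis])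

/-! ### All moves are balanced -/

theorem Balanced.exchange_off (f g : OffEvent Unit) (i k n : ℕ) :
    Balanced n [.off f i, .off g (i + (Event.off f 0).out + k)]
      [.off g (i + (Event.off f 0).inn + k), .off f i] := by
  refine Balanced.iterate_shift
    (a := fun i => [.off f i, .off g (i + (Event.off f 0).out + k)])
    (b := fun i => [.off g (i + (Event.off f 0).inn + k), .off f i])
    (by simp [Word.OffAxis]) (by simp [Word.OffAxis]) (by simp) (by simp)
    (fun i => by simp [Event.shift]; omega) (fun i => by simp [Event.shift]; omega) ?_ i n
  intro n u v _
  -- Writing the position of `g` as `k + 2` lets `Event.admits_off_succ` peel off both strands of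
  -- `f`, after which `g` stands at position `k` on either side.
  rcases f with ⟨⟨⟩⟩ | ⟨⟨⟩⟩ | _ <;>
    simp only [Event.out, Event.inn, Word.admits_cons, Word.admits_nil, Event.admits_cup,
      Event.admits_cap, Event.admits_cross, Nat.zero_add, Nat.add_comm 2 k,
      Event.admits_off_succ, Nat.add_zero] <;> aesop

theorem Balanced.exchange (e : Event Unit) (g : OffEvent Unit) (k n : ℕ) :
    Balanced n [e, .off g (e.pos + e.out + k)] [.off g (e.pos + e.inn + k), e] := by
  rcases e with ⟨f, i⟩ | f
  · have := Balanced.exchange_off f g i k n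
    rcases f with _ | _ | _ <;> exact this
  · intro u v _
    rcases f with ⟨⟨⟩⟩ | ⟨⟨⟩⟩ | _ <;>
    simp only [Event.out, Event.inn, Word.admits_cons, Word.admits_nil, Event.admits_min,
      Event.admits_max, Event.admits_axisCross, Event.pos, Nat.zero_add, Nat.add_comm 1 k,
      Event.admits_off_succ, Nat.add_zero] <;> aesop

theorem Balanced.zigzag_left (i n : ℕ) (hn : i + 1 ≤ n) :
    Balanced n [.off (.cup ()) i, .off (.cap ()) (i + 1)] [] := by
  refine Balanced.iterate_shift_nil (a := fun i => [.off (.cup ()) i, .off (.cap ()) (i + 1)])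
    (by simp [Word.OffAxis]) (by simp [Event.shift]) ?_ i n hn
  rintro n hn (_ | ⟨a, u⟩) v hu
  · simp at hu; omega
  simp only [Word.admits_cons, Word.admits_nil, Event.admits_cup, Event.admits_cap,
    Event.admits_off_succ]
  aesop

theorem Balanced.zigzag_right (i n : ℕ) (hn : i + 1 ≤ n) :
    Balanced n [.off (.cup ()) (i + 1), .off (.cap ()) i] [] := by
  refine Balanced.iterate_shift_nil (a := fun i => [.off (.cup ()) (i + 1), .off (.cap ()) i])
    (by simp [Word.OffAxis]) (by simp [Event.shift]) ?_ i n hn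
  rintro n hn (_ | ⟨a, u⟩) v hu
  · simp at hu; omega
  simp only [Word.admits_cons, Word.admits_nil, Event.admits_cup, Event.admits_cap,
    Event.admits_off_succ]
  aesop

theorem Balanced.slide_cup (i : ℕ) (s : Bool) (n : ℕ) :
    Balanced n [.off (.cup ()) (i + 1), .off (.cross s) i]
      [.off (.cup ()) i, .off (.cross (!s)) (i + 1)] := by
  refine Balanced.iterate_shift (a := fun i => [.off (.cup ()) (i + 1), .off (.cross s) i])
    (b := fun i => [.off (.cup ()) i, .off (.cross (!s)) (i + 1)])
    (by simp [Word.OffAxis]) (by simp [Word.OffAxis]) (by simp) (by simp)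
    (by simp [Event.shift]) (by simp [Event.shift]) ?_ i n
  intro n u v _
  simp only [Word.admits_cons, Word.admits_nil, Event.admits_cup, Event.admits_cross,
    Event.admits_off_succ]
  aesop

theorem Balanced.slide_cap (i : ℕ) (s : Bool) (n : ℕ) :
    Balanced n [.off (.cross s) i, .off (.cap ()) (i + 1)]
      [.off (.cross (!s)) (i + 1), .off (.cap ()) i] := by
  refine Balanced.iterate_shift (a := fun i => [.off (.cross s) i, .off (.cap ()) (i + 1)])
    (b := fun i => [.off (.cross (!s)) (i + 1), .off (.cap ()) i])
    (by simp [Word.OffAxis]) (by simp [Word.OffAxis]) (by simp) (by simp)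
    (by simp [Event.shift]) (by simp [Event.shift]) ?_ i n
  intro n u v _
  simp only [Word.admits_cons, Word.admits_nil, Event.admits_cap, Event.admits_cross,
    Event.admits_off_succ]
  aesop

theorem Balanced.r1_right (i : ℕ) (s : Bool) (n : ℕ) (hn : i + 1 ≤ n) :
    Balanced n [.off (.cup ()) (i + 1), .off (.cross s) i, .off (.cap ()) (i + 1)] [] := by
  refine Balanced.iterate_shift_nil
    (a := fun i => [.off (.cup ()) (i + 1), .off (.cross s) i, .off (.cap ()) (i + 1)])
    (by simp [Word.OffAxis]) (by simp [Event.shift]) ?_ i n hn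
  rintro n hn (_ | ⟨a, u⟩) v hu
  · simp at hu; omega
  simp only [Word.admits_cons, Word.admits_nil, Event.admits_cup,
      Event.admits_cap, Event.admits_cross, Event.admits_off_succ]
  aesop

theorem Balanced.r1_left (i : ℕ) (s : Bool) (n : ℕ) (hn : i + 1 ≤ n) :
    Balanced n [.off (.cup ()) i, .off (.cross s) (i + 1), .off (.cap ()) i] [] := by
  refine Balanced.iterate_shift_nil
    (a := fun i => [.off (.cup ()) i, .off (.cross s) (i + 1), .off (.cap ()) i])
    (by simp [Word.OffAxis]) (by simp [Event.shift]) ?_ i n hn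
  rintro n hn (_ | ⟨a, u⟩) v hu
  · simp at hu; omega
  simp only [Word.admits_cons, Word.admits_nil, Event.admits_cup,
      Event.admits_cap, Event.admits_cross, Event.admits_off_succ]
  aesop

theorem Balanced.r2 (i : ℕ) (s : Bool) (n : ℕ) (hn : i + 2 ≤ n) :
    Balanced n [.off (.cross s) i, .off (.cross (!s)) i] [] := by
  refine Balanced.iterate_shift_nil
    (a := fun i => [.off (.cross s) i, .off (.cross (!s)) i])
    (by simp [Word.OffAxis]) (by simp [Event.shift]) ?_ i n hn
  rintro n hn (_ | ⟨a, _ | ⟨b, u⟩⟩) v hu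
  · simp at hu; omega
  · simp at hu; omega
  simp only [Word.admits_cons, Word.admits_nil, Event.admits_cross]
  cases a <;> cases b <;> aesop

theorem Balanced.r3 (i : ℕ) (a b c : Bool) (n : ℕ) :
    Balanced n [.off (.cross a) i, .off (.cross b) (i + 1), .off (.cross c) i]
        [.off (.cross c) (i + 1), .off (.cross b) i, .off (.cross a) (i + 1)] := by
  refine Balanced.iterate_shift
    (a := fun i => [.off (.cross a) i, .off (.cross b) (i + 1), .off (.cross c) i])
    (b := fun i => [.off (.cross c) (i + 1), .off (.cross b) i, .off (.cross a) (i + 1)])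
    (by simp [Word.OffAxis]) (by simp [Word.OffAxis]) (by simp) (by simp)
    (by simp [Event.shift]) (by simp [Event.shift]) ?_ i n
  intro n u v _
  simp only [Word.admits_cons, Word.admits_nil, Event.admits_cross, Event.admits_off_succ]
  aesop

theorem Balanced.fork_max (n : ℕ) :
    Balanced n [.on (.max ())] [.on (.min ()), .off (.cap ()) 0] := by
  intro u v _
  simp only [Word.admits_cons, Word.admits_nil, Event.admits_cap, Event.admits_min,
    Event.admits_max]
  aesop

theorem Balanced.fork_min (n : ℕ) :
    Balanced n [.on (.min ())] [.off (.cup ()) 0, .on (.max ())] := by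
  intro u v _
  simp only [Word.admits_cons, Word.admits_nil, Event.admits_cup, Event.admits_min,
    Event.admits_max]
  aesop

theorem Balanced.axisMove {a b : Word Unit} (h : AxisMove a b) (n : ℕ) : Balanced n a b := by
  intro u v _
  cases h <;>
  simp only [Word.admits_cons, Word.admits_nil, Event.admits_cup, Event.admits_cap,
    Event.admits_cross, Event.admits_off_succ, Event.admits_min, Event.admits_max,
    Event.admits_axisCross] <;> aesop

theorem Balanced.s1Move {a b : Word Unit} (h : S1Move a b) (n : ℕ) : Balanced n a b := by
  intro u v _
  cases h <;>
  simp only [Word.admits_cons, Word.admits_nil, Event.admits_min, Event.admits_max,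
    Event.admits_axisCross] <;> aesop

theorem Balanced.s2vMove {a b : Word Unit} (h : S2vMove a b) (n : ℕ) (hn : 1 ≤ n) :
    Balanced n a b := by
  rintro (_ | ⟨x, u⟩) v hu
  · simp at hu; omega
  cases h
  simp only [Word.admits_cons, Word.admits_nil, Event.admits_axisCross]
  aesop

/-! ### Interchangeable words -/

/-- An equivalence relation on diagrams that contains the steps of symmetric equivalence. -/
structure IsMoveRelation (R : SymDiagram → SymDiagram → Prop) : Prop where
  equivalence : Equivalence R
  step : ∀ {D E : SymDiagram}, SymStep D E → R D E

/-- Every oriented form of `a` on `n` strands can be replaced, in any diagram and up to `R`, by an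
oriented form of `b`. -/
def Transfers (R : SymDiagram → SymDiagram → Prop) (n : ℕ) (a b : Word Unit) : Prop :=
  ∀ (u v : List Bool) (a' : Word Bool), u.length = n → a'.forget = a →
    ∀ ha : Runs a' u v, ∃ (b' : Word Bool) (hb : Runs b' u v), b'.forget = b ∧
      ∀ (p q : Word Bool) (hp : Runs p [] u) (hq : Runs q v []),
        R ⟨p ++ a' ++ q, (hp.append ha).append hq⟩ ⟨p ++ b' ++ q, (hp.append hb).append hq⟩

/-- On `n` strands the words `a` and `b` can be replaced by each other up to `R`. -/
def Conv (R : SymDiagram → SymDiagram → Prop) (n : ℕ) (a b : Word Unit) : Prop :=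
  Transfers R n a b ∧ Transfers R n b a

variable {R : SymDiagram → SymDiagram → Prop}

theorem Conv.symm {n : ℕ} {a b : Word Unit} (h : Conv R n a b) : Conv R n b a := ⟨h.2, h.1⟩

theorem Word.forget_eq_append {w : Word Bool} {a b : Word Unit} (h : w.forget = a ++ b) :
    ∃ a' b', w = a' ++ b' ∧ Word.forget a' = a ∧ Word.forget b' = b :=
  List.map_eq_append_iff.mp h

theorem Word.forget_append (w z : Word Bool) : Word.forget (w ++ z) = w.forget ++ z.forget :=
  List.map_append

/-- The word `c` is absorbed into the part `p` of the diagram below and `d` into the part `q` above.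
This works because `b'` is chosen before `p` and `q`. -/
theorem Transfers.within {n : ℕ} {a b : Word Unit} (c d : Word Unit)
    (h : Transfers R (Word.top c n) a b) : Transfers R n (c ++ a ++ d) (c ++ b ++ d) := by
  intro u v w hu hw hr
  obtain ⟨ca, d', rfl, hca, hd⟩ := Word.forget_eq_append hw
  obtain ⟨c', a', rfl, hc, ha⟩ := Word.forget_eq_append hca
  obtain ⟨t, hr, hdr⟩ := Runs.append_iff.mp hr
  obtain ⟨s, hcr, har⟩ := Runs.append_iff.mp hr
  obtain ⟨b', hbr, hb, H⟩ := h s t a' (by rw [hcr.length_eq, hc, hu]) ha har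
  refine ⟨c' ++ b' ++ d', (hcr.append hbr).append hdr, by simp [Word.forget_append, *], ?_⟩
  intro p q hp hq
  have := H (p ++ c') (d' ++ q) (hp.append hcr) (hdr.append hq)
  simpa only [List.append_assoc] using this

/-- The default proofs of `hw` and `hw'` allow the two words to be written in whatever bracketing is
convenient. -/
theorem Conv.within {n : ℕ} {a b w w' : Word Unit} (c d : Word Unit)
    (h : Conv R (Word.top c n) a b) (hw : w = c ++ a ++ d := by simp <;> rfl)
    (hw' : w' = c ++ b ++ d := by simp <;> rfl) : Conv R n w w' := by
  subst hw hw'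
  exact ⟨h.1.within c d, h.2.within c d⟩

/-- Balance supplies an orientation of `b` with the boundary of the given orientation of `a`, which
is what `Local` asks for. -/
theorem Transfers.of_local {M : Word Unit → Word Unit → Prop} {n : ℕ} {a b : Word Unit}
    (hM : ∀ {D E : SymDiagram}, Local M D E → R D E) (h : M a b)
    (hab : Balanced n a b) : Transfers R n a b := by
  intro u v a' hu ha hr
  obtain ⟨b', hb, hbr⟩ := (hab u v hu).mp ⟨a', ha, hr⟩
  exact ⟨b', hbr, hb, fun p q hp hq =>
    hM ⟨p, a', b', q, u, v, rfl, rfl, by rwa [ha, hb], hp, hr, hbr, hq⟩⟩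

theorem Local.symm {M : Word Unit → Word Unit → Prop} {D E : SymDiagram} (h : Local M D E) :
    Local (fun a b => M b a) E D := by
  obtain ⟨p, a, b, q, u, v, hD, hE, hM, hp, ha, hb, hq⟩ := h
  exact ⟨p, b, a, q, u, v, hE, hD, hM, hp, hb, ha, hq⟩

namespace IsMoveRelation

theorem conv_of_local (hR : IsMoveRelation R) {M : Word Unit → Word Unit → Prop} {n : ℕ}
    {a b : Word Unit} (hM : ∀ {D E : SymDiagram}, Local M D E → R D E) (h : M a b)
    (hab : Balanced n a b) : Conv R n a b :=
  ⟨.of_local hM h hab, .of_local (M := fun a b => M b a)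
    (fun h => hR.equivalence.symm (hM h.symm)) h (fun u v hu => (hab u v hu).symm)⟩

variable (hR : IsMoveRelation R)
include hR

theorem refl (n : ℕ) (a : Word Unit) : Conv R n a a :=
  have h : Transfers R n a a :=
    fun _ _ a' _ ha hr => ⟨a', hr, ha, fun _ _ _ _ => hR.equivalence.refl _⟩
  ⟨h, h⟩

theorem trans {n : ℕ} {a b c : Word Unit} (h : Conv R n a b) (h' : Conv R n b c) :
    Conv R n a c := by
  have key : ∀ {a b c}, Transfers R n a b → Transfers R n b c → Transfers R n a c := by
    intro a b c h h' u v a' hu ha hr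
    obtain ⟨b', hbr, hb, H⟩ := h u v a' hu ha hr
    obtain ⟨c', hcr, hc, H'⟩ := h' u v b' hu hb hbr
    exact ⟨c', hcr, hc, fun p q hp hq => hR.equivalence.trans (H p q hp hq) (H' p q hp hq)⟩
  exact ⟨key h.1 h'.1, key h'.2 h.2⟩

theorem planar {n : ℕ} {a b : Word Unit} (h : PlanarIsotopy a b) (hab : Balanced n a b) :
    Conv R n a b :=
  hR.conv_of_local (fun h => hR.step (.inl h)) h hab

theorem offAxis {n : ℕ} {a b : Word Unit} (h : OffAxisMove a b) (hab : Balanced n a b) :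
    Conv R n a b :=
  hR.conv_of_local (fun h => hR.step (.inr (.inr (.inl h)))) h hab

theorem onAxis {a b : Word Unit} (h : AxisMove a b) (n : ℕ) : Conv R n a b :=
  hR.conv_of_local (fun h => hR.step (.inr (.inr (.inr (.inl h))))) h (.axisMove h n)

theorem s1 {a b : Word Unit} (h : S1Move a b) (n : ℕ) : Conv R n a b :=
  hR.conv_of_local (fun h => hR.step (.inr (.inr (.inr (.inr h))))) h (.s1Move h n)

end IsMoveRelation

/-! ### Rewriting words -/

/-- A minimum off the axis. -/
abbrev cup (i : ℕ) : Event Unit := .off (.cup ()) i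

/-- A maximum off the axis. -/
abbrev cap (i : ℕ) : Event Unit := .off (.cap ()) i

/-- A crossing off the axis. -/
abbrev crs (s : Bool) (i : ℕ) : Event Unit := .off (.cross s) i

/-- Consecutive crossings of the same type on the axis. -/
abbrev axisTwists (m : Bool) (k : ℕ) : Word Unit := List.replicate k (.on (.cross m))

namespace IsMoveRelation

variable (hR : IsMoveRelation R)
include hR

theorem exchange (e : Event Unit) (g : OffEvent Unit) (k n : ℕ) :
    Conv R n [e, .off g (e.pos + e.out + k)] [.off g (e.pos + e.inn + k), e] :=
  hR.planar (.exchange e g k) (.exchange e g k n)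

theorem crs_far (s : Bool) (i : ℕ) (g : OffEvent Unit) (k n : ℕ) :
    Conv R n [crs s i, .off g (i + 2 + k)] [.off g (i + 2 + k), crs s i] :=
  hR.exchange (crs s i) g k n

theorem cup_far (i : ℕ) (g : OffEvent Unit) (k n : ℕ) :
    Conv R n [cup i, .off g (i + 2 + k)] [.off g (i + k), cup i] :=
  hR.exchange (cup i) g k n

theorem cap_far (i : ℕ) (g : OffEvent Unit) (k n : ℕ) :
    Conv R n [cap i, .off g (i + k)] [.off g (i + 2 + k), cap i] :=
  hR.exchange (cap i) g k n

theorem crs_cancel (s : Bool) (i n : ℕ) (hn : i + 2 ≤ n) :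
    Conv R n [crs s i, crs (!s) i] [] :=
  hR.offAxis (.r2 i s) (.r2 i s n hn)

theorem crs_cancel' (s : Bool) (i n : ℕ) (hn : i + 2 ≤ n) :
    Conv R n [crs (!s) i, crs s i] [] := by
  simpa using hR.crs_cancel (!s) i n hn

theorem slide_cup (s : Bool) (i n : ℕ) :
    Conv R n [cup (i + 1), crs s i] [cup i, crs (!s) (i + 1)] :=
  hR.planar (.slide_cup i s) (.slide_cup i s n)

theorem slide_cap (s : Bool) (i n : ℕ) :
    Conv R n [crs s i, cap (i + 1)] [crs (!s) (i + 1), cap i] :=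
  hR.planar (.slide_cap i s) (.slide_cap i s n)

/-- A strand passes from the left to the right of a minimum. -/
theorem cup_pass (s : Bool) (i n : ℕ) (hn : i + 1 ≤ n) :
    Conv R n [cup (i + 1), crs s i, crs s (i + 1)] [cup i] :=
  hR.trans (b := [cup i, crs (!s) (i + 1), crs s (i + 1)])
    (.within [] [crs s (i + 1)] (hR.slide_cup s i _))
    (.within [cup i] [] (hR.crs_cancel' s (i + 1) _ (by simp [Word.top, Event.top]; omega)))

/-- A minimum passes from the left to the right of a strand. -/
theorem cup_pass' (s : Bool) (i n : ℕ) (hn : i + 1 ≤ n) :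
    Conv R n [cup i, crs s (i + 1), crs s i] [cup (i + 1)] :=
  hR.trans (b := [cup (i + 1), crs (!s) i, crs s i])
    (.within [] [crs s i] (by simpa using (hR.slide_cup (!s) i _).symm))
    (.within [cup (i + 1)] [] (hR.crs_cancel' s i _ (by simp [Word.top, Event.top]; omega)))

/-- A maximum passes from the left to the right of a strand. -/
theorem cap_pass (s : Bool) (i n : ℕ) (hn : i + 3 ≤ n) :
    Conv R n [crs s (i + 1), crs s i, cap (i + 1)] [cap i] :=
  hR.trans (b := [crs s (i + 1), crs (!s) (i + 1), cap i])
    (.within [crs s (i + 1)] [] (hR.slide_cap s i _))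
    (.within [] [cap i] (hR.crs_cancel s (i + 1) _ (by simp [Word.top]; omega)))

/-- An event at a positive position does not touch strand `0`, the only strand of the right half in
the stack. -/
theorem axisTwists_comm (m : Bool) (k : ℕ) (g : OffEvent Unit) (j n : ℕ) :
    Conv R n (axisTwists m k ++ [.off g (j + 1)]) ([.off g (j + 1)] ++ axisTwists m k) := by
  induction k generalizing n with
  | zero => exact hR.refl n _
  | succ k ih =>
    have h : Conv R n [.on (.cross m), .off g (j + 1)] [.off g (j + 1), .on (.cross m)] := by
      have := hR.exchange (.on (.cross m)) g j n
      simpa [Event.pos, Event.out, Event.inn, Nat.add_comm] using this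
    exact hR.trans (.within [.on (.cross m)] [] (ih _) (by simp [List.replicate_succ]))
      (.within (w := Event.on (.cross m) :: .off g (j + 1) :: axisTwists m k) []
        (axisTwists m k) h rfl (by simp [List.replicate_succ]))

theorem cup_axisTwists_far (m : Bool) (k : ℕ) (g : OffEvent Unit) (j n : ℕ) :
    Conv R n (cup 0 :: axisTwists m k ++ [.off g (j + 2)])
      (.off g j :: cup 0 :: axisTwists m k) :=
  hR.trans (b := cup 0 :: .off g (j + 2) :: axisTwists m k)
    (.within [cup 0] [] (hR.axisTwists_comm m k g (j + 1) _))
    (.within [] (axisTwists m k) (a := [cup 0, .off g (j + 2)]) (b := [.off g j, cup 0])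
      (by simpa [Nat.add_comm] using hR.cup_far 0 g j _))

theorem axisTwists_cap_far (m : Bool) (k : ℕ) (g : OffEvent Unit) (j n : ℕ) :
    Conv R n (.off g (j + 2) :: axisTwists m k ++ [cap 0])
      (axisTwists m k ++ [cap 0, .off g j]) :=
  hR.trans (b := axisTwists m k ++ [.off g (j + 2), cap 0])
    (.within [] [cap 0] (hR.axisTwists_comm m k g (j + 1) _).symm)
    (.within (axisTwists m k) [] (by simpa [Nat.add_comm] using (hR.cap_far 0 g j _).symm))

/-- Crossings on the axis with the lower end bent upwards and back. -/
theorem axisTwists_bend_lower (m : Bool) (k n : ℕ) (hn : 1 ≤ n) :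
    Conv R n (cup 0 :: axisTwists m k ++ [cap 1]) (axisTwists m k) :=
  hR.trans (b := cup 0 :: cap 1 :: axisTwists m k)
    (.within [cup 0] [] (hR.axisTwists_comm m k (.cap ()) 0 _))
    (.within [] (axisTwists m k) (hR.planar (.zigzag_left 0) (.zigzag_left 0 n hn)))

/-- Crossings on the axis with the upper end bent downwards and back. -/
theorem axisTwists_bend_upper (m : Bool) (k n : ℕ) (hn : 1 ≤ n) :
    Conv R n (cup 1 :: axisTwists m k ++ [cap 0]) (axisTwists m k) :=
  hR.trans (b := axisTwists m k ++ [cup 1, cap 0])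
    (.within [] [cap 0] (hR.axisTwists_comm m k (.cup ()) 0 _).symm)
    (.within (axisTwists m k) [] (hR.planar (.zigzag_right 0) (.zigzag_right 0 _
      (by rwa [Word.top_replicate_axisCross]))))

/-- A maximum between the two strands of one pair slides through the passage of this pair across
another one. -/
theorem cap_pair_pass (s : Bool) (n : ℕ) (hn : 6 ≤ n) :
    Conv R n [crs s 3, crs s 2, crs s 4, crs s 3, crs s 1, crs s 0, crs s 2, crs s 1, cap 3]
      [cap 1, crs s 1, crs s 0, crs s 2, crs s 1] := by
  -- The travelling pair consists of strands `4` and `5`, and the maximum joins strands `1` and `2`.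
  -- The two crossings of strand `5` with these are brought directly below the maximum and removed
  -- by `cap_pass`; then the same is done for strand `4`.
  have e1 := hR.trans
    (.within (n := n) (w := [crs s 3, crs s 2, crs s 4, crs s 3, crs s 1, crs s 0, crs s 2, crs s 1,
        cap 3]) (w' := [crs s 3, crs s 2, crs s 4, crs s 1, crs s 3, crs s 0, crs s 2, crs s 1,
        cap 3]) [crs s 3, crs s 2, crs s 4] [crs s 0, crs s 2, crs s 1, cap 3]
      (hR.crs_far s 1 (.cross s) 0 _).symm)
    (.within (w' := [crs s 3, crs s 2, crs s 1, crs s 4, crs s 3, crs s 0, crs s 2, crs s 1,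
        cap 3]) [crs s 3, crs s 2] [crs s 3, crs s 0, crs s 2, crs s 1, cap 3]
      (hR.crs_far s 1 (.cross s) 1 _).symm)
  have e2 := hR.trans e1
    (.within (w' := [crs s 3, crs s 2, crs s 1, crs s 4, crs s 0, crs s 3, crs s 2, crs s 1,
        cap 3]) [crs s 3, crs s 2, crs s 1, crs s 4] [crs s 2, crs s 1, cap 3]
      (hR.crs_far s 0 (.cross s) 1 _).symm)
  have e3 := hR.trans e2
    (.within (w' := [crs s 3, crs s 2, crs s 1, crs s 4, crs s 0, crs s 3, crs s 2, cap 3,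
        crs s 1]) [crs s 3, crs s 2, crs s 1, crs s 4, crs s 0, crs s 3, crs s 2] []
      (hR.crs_far s 1 (.cap ()) 0 _))
  have e4 := hR.trans e3
    (.within (w' := [crs s 3, crs s 2, crs s 1, crs s 4, crs s 0, cap 2, crs s 1])
      [crs s 3, crs s 2, crs s 1, crs s 4, crs s 0] [crs s 1]
      (hR.cap_pass s 2 _ (by simp [Word.top, Event.top]; omega)))
  have e5 := hR.trans e4
    (.within (w' := [crs s 3, crs s 2, crs s 1, crs s 4, cap 2, crs s 0, crs s 1])
      [crs s 3, crs s 2, crs s 1, crs s 4] [crs s 1] (hR.crs_far s 0 (.cap ()) 0 _))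
  have e6 := hR.trans e5
    (.within (w' := [crs s 3, crs s 2, crs s 1, cap 2, crs s 2, crs s 0, crs s 1])
      [crs s 3, crs s 2, crs s 1] [crs s 0, crs s 1] (hR.cap_far 2 (.cross s) 0 _).symm)
  have e7 := hR.trans e6
    (.within (w' := [crs s 3, cap 1, crs s 2, crs s 0, crs s 1])
      [crs s 3] [crs s 2, crs s 0, crs s 1]
      (hR.cap_pass s 1 _ (by simp [Word.top, Event.top]; omega)))
  have e8 := hR.trans e7
    (.within (w' := [cap 1, crs s 1, crs s 2, crs s 0, crs s 1])
      [] [crs s 2, crs s 0, crs s 1] (hR.cap_far 1 (.cross s) 0 _).symm)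
  exact hR.trans e8
    (.within [cap 1, crs s 1] [crs s 1] (hR.crs_far s 0 (.cross s) 0 _).symm)

/-- A minimum between two strands slides through the passage of another pair of strands. -/
theorem cup_pair_pass (s : Bool) (n : ℕ) (hn : 4 ≤ n) :
    Conv R n [cup 3, crs s 1, crs s 0, crs s 2, crs s 1, crs s 3, crs s 2, crs s 4, crs s 3]
      [crs s 1, crs s 0, crs s 2, crs s 1, cup 1] := by
  -- The travelling pair consists of strands `0` and `1`. Strand `1` is freed from the minimum first
  -- and strand `0` second, each by `cup_pass`.
  have e1 := hR.trans
    (.within (n := n) (w := [cup 3, crs s 1, crs s 0, crs s 2, crs s 1, crs s 3, crs s 2, crs s 4,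
        crs s 3]) (w' := [crs s 1, cup 3, crs s 0, crs s 2, crs s 1, crs s 3, crs s 2, crs s 4,
        crs s 3]) [] [crs s 0, crs s 2, crs s 1, crs s 3, crs s 2, crs s 4, crs s 3]
      (hR.crs_far s 1 (.cup ()) 0 _).symm)
    (.within (w' := [crs s 1, crs s 0, cup 3, crs s 2, crs s 1, crs s 3, crs s 2, crs s 4,
        crs s 3]) [crs s 1] [crs s 2, crs s 1, crs s 3, crs s 2, crs s 4, crs s 3]
      (hR.crs_far s 0 (.cup ()) 1 _).symm)
  have e2 := hR.trans e1
    (.within (w' := [crs s 1, crs s 0, cup 3, crs s 2, crs s 3, crs s 1, crs s 2, crs s 4,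
        crs s 3]) [crs s 1, crs s 0, cup 3, crs s 2] [crs s 2, crs s 4, crs s 3]
      (hR.crs_far s 1 (.cross s) 0 _))
  have e3 := hR.trans e2
    (.within (w' := [crs s 1, crs s 0, cup 2, crs s 1, crs s 2, crs s 4, crs s 3])
      [crs s 1, crs s 0] [crs s 1, crs s 2, crs s 4, crs s 3]
      (hR.cup_pass s 2 _ (by simp [Word.top, Event.top]; omega)))
  have e4 := hR.trans e3
    (.within (w' := [crs s 1, crs s 0, cup 1, crs s 4, crs s 3])
      [crs s 1, crs s 0] [crs s 4, crs s 3]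
      (hR.cup_pass s 1 _ (by simp [Word.top, Event.top]; omega)))
  have e5 := hR.trans e4
    (.within (w' := [crs s 1, crs s 0, crs s 2, cup 1, crs s 3])
      [crs s 1, crs s 0] [crs s 3] (hR.cup_far 1 (.cross s) 1 _))
  exact hR.trans e5
    (.within [crs s 1, crs s 0, crs s 2] [] (hR.cup_far 1 (.cross s) 0 _))

/-- A loop between two strands is removed from below one of them. -/
theorem loop_pass (s : Bool) (n : ℕ) (hn : 3 ≤ n) :
    Conv R n [cup 2, crs s 3, crs s 1, crs s 0, crs s 2, crs s 1, crs s 3, cap 2] [crs s 1] := by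
  have e1 := hR.trans
    (.within (n := n) (w := [cup 2, crs s 3, crs s 1, crs s 0, crs s 2, crs s 1, crs s 3, cap 2])
      (w' := [cup 2, crs s 3, crs s 1, crs s 0, crs s 2, crs s 3, crs s 1, cap 2])
      [cup 2, crs s 3, crs s 1, crs s 0, crs s 2] [cap 2] (hR.crs_far s 1 (.cross s) 0 _))
    (.within (w' := [cup 2, crs s 1, crs s 3, crs s 0, crs s 2, crs s 3, crs s 1, cap 2])
      [cup 2] [crs s 0, crs s 2, crs s 3, crs s 1, cap 2] (hR.crs_far s 1 (.cross s) 0 _).symm)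
  have e2 := hR.trans e1
    (.within (w' := [cup 2, crs s 1, crs s 0, crs s 3, crs s 2, crs s 3, crs s 1, cap 2])
      [cup 2, crs s 1] [crs s 2, crs s 3, crs s 1, cap 2] (hR.crs_far s 0 (.cross s) 1 _).symm)
  -- An arc of the loop moves across the crossing of strands `1` and `2`. Afterwards strand `1`
  -- leaves through the minimum of the loop and strand `2` through its maximum, and only a kink in
  -- strand `0` remains.
  have e3 := hR.trans e2
    (.within (w' := [cup 2, crs s 1, crs s 0, crs s 2, crs s 3, crs s 2, crs s 1, cap 2])
      [cup 2, crs s 1, crs s 0] [crs s 1, cap 2]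
      (hR.offAxis (.r3 2 s s s (.inl rfl)) (.r3 2 s s s _)).symm)
  have e4 := hR.trans e3
    (.within (w' := [cup 2, crs s 1, crs s 2, crs s 0, crs s 3, crs s 2, crs s 1, cap 2])
      [cup 2, crs s 1] [crs s 3, crs s 2, crs s 1, cap 2] (hR.crs_far s 0 (.cross s) 0 _))
  have e5 := hR.trans e4
    (.within (w' := [cup 1, crs s 0, crs s 3, crs s 2, crs s 1, cap 2])
      [] [crs s 0, crs s 3, crs s 2, crs s 1, cap 2]
      (hR.cup_pass s 1 _ (by simp [Word.top]; omega)))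
  have e6 := hR.trans e5
    (.within (w' := [cup 1, crs s 0, crs s 3, cap 1]) [cup 1, crs s 0, crs s 3] []
      (hR.cap_pass s 1 _ (by simp [Word.top, Event.top]; omega)))
  have e7 := hR.trans e6
    (.within (w' := [cup 1, crs s 0, cap 1, crs s 1]) [cup 1, crs s 0] []
      (hR.cap_far 1 (.cross s) 0 _).symm)
  exact hR.trans e7
    (.within [] [crs s 1] (hR.offAxis (.r1_right 0 s) (.r1_right 0 s n (by omega))))

end IsMoveRelation

/-! ### Twisted moves on the axis -/

/-- `A` and `B` on the axis exchange their places, one of them passing over or under the other. -/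
def Swaps (R : SymDiagram → SymDiagram → Prop) (s : Bool) (A B : Word Unit) : Prop :=
  ∀ n, 2 ≤ n → Conv R n
    (cup 0 :: A ++ [crs s 1, crs s 0, crs s 2, crs s 1] ++ B ++ [cap 0])
    (B ++ [cap 0, cup 0] ++ A)

namespace IsMoveRelation

variable (hR : IsMoveRelation R)
include hR

/-- S4 for `h = 0`: the minimum moves outwards past the two strands of the other arc and is then far
from the maximum. -/
theorem swaps_nil (s : Bool) : Swaps R s [] [] := by
  intro n hn
  have e1 := hR.trans
    (.within (n := n) (w := [cup 0, crs s 1, crs s 0, crs s 2, crs s 1, cap 0])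
      (w' := [cup 1, crs s 2, crs s 1, cap 0])
      [] [crs s 2, crs s 1, cap 0] (hR.cup_pass' s 0 _ (by simp [Word.top]; omega)))
    (.within (w' := [cup 2, cap 0]) [] [cap 0]
      (hR.cup_pass' s 1 _ (by simp [Word.top]; omega)))
  exact hR.trans e1 (hR.cap_far 0 (.cup ()) 0 n).symm

theorem swaps_one (s m m' : Bool) : Swaps R s (axisTwists m 1) (axisTwists m' 1) :=
  fun n _ => hR.onAxis (.s4 s m' m) n

/-- With a zigzag between `A₁` and `A₂`, each part has a lower end of its own and passes `B`
separately: first `A₂`, which is next to `B`, then `A₁`. -/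
theorem swaps_add_left {s m m' : Bool} {i j k : ℕ}
    (h₁ : Swaps R s (axisTwists m i) (axisTwists m' k))
    (h₂ : Swaps R s (axisTwists m j) (axisTwists m' k)) :
    Swaps R s (axisTwists m i ++ axisTwists m j) (axisTwists m' k) := by
  intro n hn
  set A₁ := axisTwists m i
  set A₂ := axisTwists m j
  set B := axisTwists m' k
  have tA₁ : ∀ n, Word.top A₁ n = n := Word.top_replicate_axisCross _ _
  have tA₂ : ∀ n, Word.top A₂ n = n := Word.top_replicate_axisCross _ _
  have e1 : Conv R n
      (cup 0 :: (A₁ ++ A₂) ++ [crs s 1, crs s 0, crs s 2, crs s 1] ++ B ++ [cap 0])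
      (cup 0 :: A₁ ++ cup 0 :: A₂ ++ [cap 1, crs s 1, crs s 0, crs s 2, crs s 1] ++ B ++ [cap 0]) :=
    .within (cup 0 :: A₁) ([crs s 1, crs s 0, crs s 2, crs s 1] ++ B ++ [cap 0])
      (hR.axisTwists_bend_lower m j _ (by simp [Word.top, Event.top, tA₁])).symm
  -- Lifting the maximum of the zigzag doubles the passage: both pairs of ends now cross the strands
  -- of `B` in full.
  have e2 := hR.trans e1 (.within (w' := cup 0 :: A₁ ++ cup 0 :: A₂ ++ [crs s 3, crs s 2, crs s 4,
      crs s 3, crs s 1, crs s 0, crs s 2, crs s 1, cap 3] ++ B ++ [cap 0])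
    (cup 0 :: A₁ ++ cup 0 :: A₂) (B ++ [cap 0])
    (hR.cap_pair_pass s _ (by simp [Word.top, Event.top, Word.top_append, tA₁, tA₂]; omega)).symm)
  have e3 := hR.trans e2 (.within (w' := cup 0 :: A₁ ++ cup 0 :: A₂ ++ [crs s 3, crs s 2, crs s 4,
      crs s 3, crs s 1, crs s 0, crs s 2, crs s 1] ++ B ++ [cap 0, cap 1])
    (cup 0 :: A₁ ++ cup 0 :: A₂ ++ [crs s 3, crs s 2, crs s 4, crs s 3, crs s 1, crs s 0, crs s 2,
      crs s 1]) [] (hR.axisTwists_cap_far m' k (.cap ()) 1 _))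
  -- The passage belonging to `A₁` moves below `A₂` and its minimum, one crossing at a time, its
  -- positions dropping by `2`.
  have e4 := hR.trans e3 (.within (w' := cup 0 :: A₁ ++ [crs s 1] ++ cup 0 :: A₂ ++ [crs s 2,
      crs s 4, crs s 3, crs s 1, crs s 0, crs s 2, crs s 1] ++ B ++ [cap 0, cap 1])
    (cup 0 :: A₁) ([crs s 2, crs s 4, crs s 3, crs s 1, crs s 0, crs s 2, crs s 1] ++ B ++
      [cap 0, cap 1]) (hR.cup_axisTwists_far m j (.cross s) 1 _))
  have e5 := hR.trans e4 (.within (w' := cup 0 :: A₁ ++ [crs s 1, crs s 0] ++ cup 0 :: A₂ ++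
      [crs s 4, crs s 3, crs s 1, crs s 0, crs s 2, crs s 1] ++ B ++ [cap 0, cap 1])
    (cup 0 :: A₁ ++ [crs s 1]) ([crs s 4, crs s 3, crs s 1, crs s 0, crs s 2, crs s 1] ++ B ++
      [cap 0, cap 1]) (hR.cup_axisTwists_far m j (.cross s) 0 _))
  have e6 := hR.trans e5 (.within (w' := cup 0 :: A₁ ++ [crs s 1, crs s 0, crs s 2] ++
      cup 0 :: A₂ ++ [crs s 3, crs s 1, crs s 0, crs s 2, crs s 1] ++ B ++ [cap 0, cap 1])
    (cup 0 :: A₁ ++ [crs s 1, crs s 0]) ([crs s 3, crs s 1, crs s 0, crs s 2, crs s 1] ++ B ++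
      [cap 0, cap 1]) (hR.cup_axisTwists_far m j (.cross s) 2 _))
  have e7 := hR.trans e6 (.within (w' := cup 0 :: A₁ ++ [crs s 1, crs s 0, crs s 2, crs s 1] ++
      cup 0 :: A₂ ++ [crs s 1, crs s 0, crs s 2, crs s 1] ++ B ++ [cap 0, cap 1])
    (cup 0 :: A₁ ++ [crs s 1, crs s 0, crs s 2]) ([crs s 1, crs s 0, crs s 2, crs s 1] ++ B ++
      [cap 0, cap 1]) (hR.cup_axisTwists_far m j (.cross s) 1 _))
  have e8 := hR.trans e7 (.within (w' := cup 0 :: A₁ ++ [crs s 1, crs s 0, crs s 2, crs s 1] ++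
      B ++ [cap 0, cup 0] ++ A₂ ++ [cap 1])
    (cup 0 :: A₁ ++ [crs s 1, crs s 0, crs s 2, crs s 1]) [cap 1]
    (h₂ _ (by simp [Word.top, Event.top, Word.top_append, tA₁])))
  have e9 := hR.trans e8 (.within (w' := B ++ [cap 0, cup 0] ++ A₁ ++ cup 0 :: A₂ ++ [cap 1])
    [] (cup 0 :: A₂ ++ [cap 1]) (h₁ _ hn))
  exact hR.trans e9 (.within (B ++ [cap 0, cup 0] ++ A₁) []
    (hR.axisTwists_bend_lower m j _ (by simp [Word.top, Event.top, Word.top_append, tA₁])))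

/-- The same argument with the zigzag between `B₁` and `B₂`: its minimum is lowered through the
passage and below `A`, and the second passage is lifted above `B₁`. -/
theorem swaps_add_right {s m m' : Bool} {i j k : ℕ}
    (h₁ : Swaps R s (axisTwists m k) (axisTwists m' i))
    (h₂ : Swaps R s (axisTwists m k) (axisTwists m' j)) :
    Swaps R s (axisTwists m k) (axisTwists m' i ++ axisTwists m' j) := by
  intro n hn
  set A := axisTwists m k
  set B₁ := axisTwists m' i
  set B₂ := axisTwists m' j
  have tA : ∀ n, Word.top A n = n := Word.top_replicate_axisCross _ _
  have tB₁ : ∀ n, Word.top B₁ n = n := Word.top_replicate_axisCross _ _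
  have e1 : Conv R n
      (cup 0 :: A ++ [crs s 1, crs s 0, crs s 2, crs s 1] ++ (B₁ ++ B₂) ++ [cap 0])
      (cup 0 :: A ++ [crs s 1, crs s 0, crs s 2, crs s 1, cup 1] ++ B₁ ++ [cap 0] ++ B₂ ++
        [cap 0]) :=
    .within (cup 0 :: A ++ [crs s 1, crs s 0, crs s 2, crs s 1]) (B₂ ++ [cap 0])
      (hR.axisTwists_bend_upper m' i _ (by simp [Word.top, Event.top, Word.top_append, tA])).symm
  have e2 := hR.trans e1 (.within (w' := cup 0 :: A ++ [cup 3, crs s 1, crs s 0, crs s 2, crs s 1,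
      crs s 3, crs s 2, crs s 4, crs s 3] ++ B₁ ++ [cap 0] ++ B₂ ++ [cap 0])
    (cup 0 :: A) (B₁ ++ [cap 0] ++ B₂ ++ [cap 0])
    (hR.cup_pair_pass s _ (by simp [Word.top, Event.top, tA]; omega)).symm)
  have e3 := hR.trans e2 (.within (w' := cup 1 :: cup 0 :: A ++ [crs s 1, crs s 0, crs s 2, crs s 1,
      crs s 3, crs s 2, crs s 4, crs s 3] ++ B₁ ++ [cap 0] ++ B₂ ++ [cap 0])
    [] ([crs s 1, crs s 0, crs s 2, crs s 1, crs s 3, crs s 2, crs s 4, crs s 3] ++ B₁ ++ [cap 0] ++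
      B₂ ++ [cap 0]) (hR.cup_axisTwists_far m k (.cup ()) 1 _))
  have e4 := hR.trans e3 (.within (w' := cup 1 :: cup 0 :: A ++ [crs s 1, crs s 0, crs s 2, crs s 1,
      crs s 3, crs s 2, crs s 4] ++ B₁ ++ [cap 0, crs s 1] ++ B₂ ++ [cap 0])
    (cup 1 :: cup 0 :: A ++ [crs s 1, crs s 0, crs s 2, crs s 1, crs s 3, crs s 2, crs s 4])
      (B₂ ++ [cap 0]) (hR.axisTwists_cap_far m' i (.cross s) 1 _))
  have e5 := hR.trans e4 (.within (w' := cup 1 :: cup 0 :: A ++ [crs s 1, crs s 0, crs s 2, crs s 1,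
      crs s 3, crs s 2] ++ B₁ ++ [cap 0, crs s 2, crs s 1] ++ B₂ ++ [cap 0])
    (cup 1 :: cup 0 :: A ++ [crs s 1, crs s 0, crs s 2, crs s 1, crs s 3, crs s 2])
      (crs s 1 :: B₂ ++ [cap 0]) (hR.axisTwists_cap_far m' i (.cross s) 2 _))
  have e6 := hR.trans e5 (.within (w' := cup 1 :: cup 0 :: A ++ [crs s 1, crs s 0, crs s 2, crs s 1,
      crs s 3] ++ B₁ ++ [cap 0, crs s 0, crs s 2, crs s 1] ++ B₂ ++ [cap 0])
    (cup 1 :: cup 0 :: A ++ [crs s 1, crs s 0, crs s 2, crs s 1, crs s 3])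
      (crs s 2 :: crs s 1 :: B₂ ++ [cap 0]) (hR.axisTwists_cap_far m' i (.cross s) 0 _))
  have e7 := hR.trans e6 (.within (w' := cup 1 :: cup 0 :: A ++ [crs s 1, crs s 0, crs s 2,
      crs s 1] ++ B₁ ++ [cap 0, crs s 1, crs s 0, crs s 2, crs s 1] ++ B₂ ++ [cap 0])
    (cup 1 :: cup 0 :: A ++ [crs s 1, crs s 0, crs s 2, crs s 1])
      (crs s 0 :: crs s 2 :: crs s 1 :: B₂ ++ [cap 0])
      (hR.axisTwists_cap_far m' i (.cross s) 1 _))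
  have e8 := hR.trans e7 (.within (w' := cup 1 :: B₁ ++ [cap 0, cup 0] ++ A ++
      [crs s 1, crs s 0, crs s 2, crs s 1] ++ B₂ ++ [cap 0])
    [cup 1] ([crs s 1, crs s 0, crs s 2, crs s 1] ++ B₂ ++ [cap 0])
    (h₁ _ (by simp [Word.top, Event.top])))
  have e9 := hR.trans e8 (.within (w' := cup 1 :: B₁ ++ [cap 0] ++ B₂ ++ [cap 0, cup 0] ++ A)
    (cup 1 :: B₁ ++ [cap 0]) []
    (h₂ _ (by simpa [Word.top, Event.top, Word.top_append, tB₁] using hn)))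
  exact hR.trans e9 (.within [] (B₂ ++ [cap 0, cup 0] ++ A)
    (hR.axisTwists_bend_upper m' i _ (by simp [Word.top]; omega)))

/-- Both stacks grow from a single crossing, where the claim is S4. An empty stack opposite a
non-empty one is not covered, and is not needed because all stacks have height `|h|`. -/
theorem swaps_axisTwists (s m m' : Bool) (i k : ℕ) :
    Swaps R s (axisTwists m (i + 1)) (axisTwists m' (k + 1)) := by
  have h : Swaps R s (axisTwists m 1) (axisTwists m' (k + 1)) := by
    induction k with
    | zero => exact hR.swaps_one s m m'
    | succ k ih =>
      simpa [axisTwists, List.replicate_add] using hR.swaps_add_right ih (hR.swaps_one s m m')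
  induction i with
  | zero => exact h
  | succ i ih => simpa [axisTwists, List.replicate_add] using hR.swaps_add_left ih h

/-- A half-turn in space of two stacks of crossings on the axis is performed on each of them. -/
theorem turn_append {s m : Bool} {i k n : ℕ} (hn : 1 ≤ n)
    (hi : Conv R n (cup 0 :: crs s 1 :: axisTwists m i ++ [cap 0]) (axisTwists m i))
    (hk : Conv R n (cup 0 :: crs s 1 :: axisTwists m k ++ [cap 0]) (axisTwists m k))
    (hs : Swaps R s (axisTwists m k) (axisTwists m i)) :
    Conv R n (axisTwists m i ++ axisTwists m k)
      (cup 0 :: crs s 1 :: (axisTwists m k ++ axisTwists m i) ++ [cap 0]) := by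
  set A := axisTwists m i
  set B := axisTwists m k
  have tA : ∀ n, Word.top A n = n := Word.top_replicate_axisCross _ _
  have tB : ∀ n, Word.top B n = n := Word.top_replicate_axisCross _ _
  -- Each stack is turned by itself, which creates one crossing off the axis for each.
  have e1 : Conv R n (A ++ B) (cup 0 :: crs s 1 :: A ++ [cap 0] ++ B) :=
    .within [] B hi.symm
  have e2 := hR.trans e1 (.within (w' := cup 0 :: crs s 1 :: A ++ [cap 0, cup 0, crs s 1] ++ B ++
      [cap 0]) (cup 0 :: crs s 1 :: A ++ [cap 0]) [] (b := cup 0 :: crs s 1 :: B ++ [cap 0])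
    (by simpa [Word.top, Event.top, Word.top_append, tA] using hk.symm))
  have e3 := hR.trans e2 (.within (w' := cup 0 :: crs s 1 :: A ++ [cap 0, cup 0] ++ B ++
      [crs s 1, cap 0]) (cup 0 :: crs s 1 :: A ++ [cap 0, cup 0]) [cap 0]
    (hR.axisTwists_comm m k (.cross s) 0 _).symm)
  -- Used backwards, `hs` puts `B` below `A`, in the order that a common half-turn produces.
  have e4 := hR.trans e3 (.within (w' := cup 0 :: crs s 1 :: cup 0 :: B ++ [crs s 1, crs s 0,
      crs s 2, crs s 1] ++ A ++ [cap 0, crs s 1, cap 0]) [cup 0, crs s 1] [crs s 1, cap 0]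
    (hs _ (by simp [Word.top, Event.top])).symm)
  -- All crossings off the axis are now collected between `B` and `A`, together with a maximum from
  -- above and a minimum from below. They form the word of `loop_pass`, which leaves the single
  -- crossing of the common half-turn.
  have e5 := hR.trans e4 (.within (w' := cup 0 :: crs s 1 :: cup 0 :: B ++ [crs s 1, crs s 0,
      crs s 2, crs s 1, crs s 3] ++ A ++ [cap 0, cap 0])
    (cup 0 :: crs s 1 :: cup 0 :: B ++ [crs s 1, crs s 0, crs s 2, crs s 1]) [cap 0]
    (hR.axisTwists_cap_far m i (.cross s) 1 _).symm)
  have e6 := hR.trans e5 (.within (w' := cup 0 :: crs s 1 :: cup 0 :: B ++ [crs s 1, crs s 0,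
      crs s 2, crs s 1, crs s 3, cap 2] ++ A ++ [cap 0])
    (cup 0 :: crs s 1 :: cup 0 :: B ++ [crs s 1, crs s 0, crs s 2, crs s 1, crs s 3]) []
    (hR.axisTwists_cap_far m i (.cap ()) 0 _).symm)
  have e7 := hR.trans e6 (.within (w' := cup 0 :: cup 0 :: B ++ [crs s 3, crs s 1, crs s 0,
      crs s 2, crs s 1, crs s 3, cap 2] ++ A ++ [cap 0]) [cup 0]
    ([crs s 1, crs s 0, crs s 2, crs s 1, crs s 3, cap 2] ++ A ++ [cap 0])
    (hR.cup_axisTwists_far m k (.cross s) 1 _).symm)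
  have e8 := hR.trans e7 (.within (w' := cup 0 :: B ++ [cup 2, crs s 3, crs s 1, crs s 0,
      crs s 2, crs s 1, crs s 3, cap 2] ++ A ++ [cap 0]) []
    ([crs s 3, crs s 1, crs s 0, crs s 2, crs s 1, crs s 3, cap 2] ++ A ++ [cap 0])
    (hR.cup_axisTwists_far m k (.cup ()) 0 _).symm)
  have e9 := hR.trans e8 (.within (w' := cup 0 :: B ++ [crs s 1] ++ A ++ [cap 0]) (cup 0 :: B)
    (A ++ [cap 0]) (hR.loop_pass s _ (by simp [Word.top, Event.top, tB]; omega)))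
  exact hR.trans e9 (.within [cup 0] (A ++ [cap 0]) (hR.axisTwists_comm m k (.cross s) 0 _))

theorem turn_axisTwists (s m : Bool) (k n : ℕ) (hn : 1 ≤ n) :
    Conv R n (cup 0 :: crs s 1 :: axisTwists m k ++ [cap 0]) (axisTwists m k) := by
  have h1 : Conv R n (cup 0 :: crs s 1 :: axisTwists m 1 ++ [cap 0]) (axisTwists m 1) :=
    hR.onAxis (.s2 s m) n
  -- Without crossings on the axis, S2(±) is the removal of an ordinary kink. The induction starts
  -- at one crossing because `swaps_axisTwists` needs non-empty stacks; the order of the two parts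
  -- is immaterial, as all crossings have type `m`.
  rcases k with _ | k
  · exact hR.offAxis (.r1_left 0 s) (.r1_left 0 s n hn)
  induction k with
  | zero => exact h1
  | succ k ih =>
    have h := (hR.turn_append hn ih h1 (hR.swaps_axisTwists s m m 0 k)).symm
    simp only [axisTwists, ← List.replicate_add] at h
    rwa [Nat.add_comm 1] at h

theorem min_crs_axisTwists (s m : Bool) (k n : ℕ) :
    Conv R n ([.on (.min ()), crs s 0] ++ axisTwists m k)
      (axisTwists m k ++ [.on (.min ()), crs s 0]) := by
  induction k generalizing n with
  | zero => exact hR.refl n _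
  | succ k ih =>
    exact hR.trans (b := .on (.cross m) :: .on (.min ()) :: crs s 0 :: axisTwists m k)
      (.within [] (axisTwists m k) (hR.onAxis (.s3_min s m) _) (by simp [List.replicate_succ]))
      (.within [.on (.cross m)] [] (ih _) (by simp) (by simp [List.replicate_succ]))

theorem axisTwists_crs_max (s m : Bool) (k n : ℕ) :
    Conv R n (axisTwists m k ++ [crs s 0, .on (.max ())])
      ([crs s 0, .on (.max ())] ++ axisTwists m k) := by
  induction k generalizing n with
  | zero => exact hR.refl n _
  | succ k ih =>
    exact hR.trans (b := .on (.cross m) :: crs s 0 :: .on (.max ()) :: axisTwists m k)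
      (.within [.on (.cross m)] [] (ih _) (by simp [List.replicate_succ]))
      (.within [] (axisTwists m k) (hR.onAxis (.s3_max s m) _) (by simp)
        (by simp [List.replicate_succ]))

theorem axisTwists_max (m : Bool) (k n : ℕ) :
    Conv R n (axisTwists m k ++ [.on (.max ())]) [.on (.max ())] := by
  induction k generalizing n with
  | zero => exact hR.refl n _
  | succ k ih =>
    exact hR.trans (b := [.on (.cross m), .on (.max ())])
      (.within [.on (.cross m)] [] (ih _) (by simp [List.replicate_succ])) (hR.s1 (.above m) _)

theorem min_axisTwists (m : Bool) (k n : ℕ) :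
    Conv R n (.on (.min ()) :: axisTwists m k) [.on (.min ())] := by
  induction k generalizing n with
  | zero => exact hR.refl n _
  | succ k ih =>
    exact hR.trans (.within [] (axisTwists m k) (hR.s1 (.below m) _)
      (by simp [List.replicate_succ])) (ih n)

theorem axisTwists_cancel (hv : ∀ {D E : SymDiagram}, Local S2vMove D E → R D E)
    (m : Bool) (k n : ℕ) (hn : 1 ≤ n) :
    Conv R n (axisTwists m k ++ axisTwists (!m) k) [] := by
  induction k with
  | zero => exact hR.refl n _
  | succ k ih =>
    -- The innermost pair of crossings is cancelled.
    refine hR.trans (b := axisTwists m k ++ axisTwists (!m) k)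
      (.within (axisTwists m k) (axisTwists (!m) k) (b := [])
        (hR.conv_of_local hv (.mk m) (.s2vMove (.mk m) _ ?_)) ?_) ih
    · rwa [Word.top_replicate_axisCross]
    · rw [axisTwists, axisTwists, List.replicate_succ', List.replicate_succ]
      simp

end IsMoveRelation

/-! ### Orientability -/

/-- The orientation of a strand that belongs to the component with number `c.1`, when the components
are oriented by `σ`. -/
def strandValue (σ : ℕ → Bool) (c : ℕ × Bool) : Bool := xor (σ c.1) c.2

theorem Word.Admits.append {w z : Word Unit} {u v t : List Bool} (hw : w.Admits u v)
    (hz : z.Admits v t) : Word.Admits (w ++ z) u t := by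
  obtain ⟨w', rfl, hw⟩ := hw
  obtain ⟨z', rfl, hz⟩ := hz
  exact ⟨w' ++ z', Word.forget_append _ _, hw.append hz⟩

theorem Passes.admits {e : Event Bool} {u v : List Bool} (h : Passes e u v) :
    Word.Admits [e.forget] u v :=
  ⟨[e], rfl, .cons h (.nil v)⟩

theorem admits_axisTwists_of_even (s a : Bool) (r : List Bool) {k : ℕ} (hk : Even k) :
    Word.Admits (axisTwists s k) (a :: r) (a :: r) := by
  obtain ⟨j, rfl⟩ := hk
  induction j with
  | zero => exact Word.admits_nil.mpr rfl
  | succ j ih =>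
    rw [show j + 1 + (j + 1) = (j + j) + 2 by ring, axisTwists, List.replicate_add]
    refine ih.append ⟨[.on (.cross s), .on (.cross s)], rfl, ?_⟩
    refine .cons (.axisCross s a r) (.cons ?_ (.nil _))
    simpa using Passes.axisCross s (!a) r

theorem exists_fst_fresh (L : List (ℕ × Bool)) : ∃ x, ∀ b, (x, b) ∉ L := by
  obtain ⟨x, hx⟩ := Infinite.exists_notMem_finset (L.map Prod.fst).toFinset
  exact ⟨x, fun b hb => hx (List.mem_toFinset.mpr (List.mem_map_of_mem hb))⟩

theorem exists_append_of_length {α : Type*} {L : List α} {i j : ℕ} (h : L.length = i + j) :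
    ∃ l r, L = l ++ r ∧ l.length = i ∧ r.length = j :=
  ⟨L.take i, L.drop i, by simp, by simp; omega, by simp; omega⟩

/-- An entry `(x, ε)` of `L` is an open end of component `x`. As `L` has no repetitions, a component
has at most two open ends, and these are oppositely oriented; hence a cap can always be oriented.
The orientation `σ` below is found from `σ'` above, since a cap may merge two components and thereby
tie their orientations together. -/
theorem Passes.exists_strands {h : ℤ} (hh : Even h) {e : Event Bool} {u v : List Bool}
    (he : Passes e u v) {L : List (ℕ × Bool)} (hL : L.Nodup) (hu : L.length = u.length) :
    ∃ L' : List (ℕ × Bool), L'.Nodup ∧ L'.length = v.length ∧ ∀ σ', ∃ σ,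
      Word.Admits (e.forget.twist h) (L.map (strandValue σ)) (L'.map (strandValue σ')) := by
  cases he with
  | cup d l r =>
    obtain ⟨x, hx⟩ := exists_fst_fresh L
    obtain ⟨l', r', rfl, hl, hr⟩ := exists_append_of_length (hu.trans List.length_append)
    refine ⟨l' ++ (x, false) :: (x, true) :: r', ?_, by simp [hl, hr], fun σ => ⟨σ, ?_⟩⟩
    · have := hx true
      have := hx false
      simp_all [List.nodup_append]
      grind
    · have := (Passes.cup (σ x) (l'.map (strandValue σ)) (r'.map (strandValue σ))).admits
      simpa [Event.forget, Event.twist, strandValue, hl] using this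
  | cap d l r =>
    obtain ⟨l', r', rfl, hl, hr⟩ := exists_append_of_length (hu.trans List.length_append)
    obtain _ | ⟨⟨x, ε⟩, _ | ⟨⟨y, δ⟩, r'⟩⟩ := r'
    · simp at hr
    · simp at hr
    have key : ∀ σ l₁ r₁, (!strandValue σ (x, ε)) = strandValue σ (y, δ) →
        l'.map (strandValue σ) = l₁ → r'.map (strandValue σ) = r₁ →
        Word.Admits (Event.twist h (Event.forget (.off (.cap d) l.length)))
        ((l' ++ (x, ε) :: (y, δ) :: r').map (strandValue σ)) (l₁ ++ r₁) := by
      rintro σ l₁ r₁ hxy rfl rfl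
      have := (Passes.cap (strandValue σ (x, ε)) (l'.map (strandValue σ))
        (r'.map (strandValue σ))).admits
      simpa [Event.forget, Event.twist, hxy, hl] using this
    by_cases hxy : x = y
    · subst hxy
      refine ⟨l' ++ r', ?_, ?_, fun σ => ⟨σ, ?_⟩⟩
      · exact hL.sublist (by simp)
      · simp at hr
        simp [hl, hr]
      · rw [List.map_append (l₁ := l') (l₂ := r')]
        refine key σ _ _ ?_ rfl rfl
        have : ε ≠ δ := by
          rintro rfl
          simp [List.nodup_append] at hL
        simp only [strandValue]
        revert this
        cases σ x <;> cases ε <;> cases δ <;> simp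
    -- The cap merges component `y` into `x`. It forces `σ y = σ x + ε + δ + 1` modulo `2`, and `φ`
    -- rewrites the ends of `y` in terms of `x` accordingly. The possible remaining ends `(x, !ε)`
    -- and `(y, !δ)` go to `(x, !ε)` and `(x, ε)`, so no repetition arises.
    · let φ : ℕ × Bool → ℕ × Bool := fun c => if c.1 = y then (x, xor (xor ε δ) (!c.2)) else c
      have hφ : ∀ σ' : ℕ → Bool, ∀ c,
          strandValue (Function.update σ' y (xor (xor (σ' x) ε) (!δ))) c =
            strandValue σ' (φ c) := by
        rintro σ' ⟨z, γ⟩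
        simp only [strandValue, φ]
        by_cases hz : z = y
        · subst hz
          simp only [Function.update_self, if_true]
          cases σ' x <;> cases ε <;> cases δ <;> cases γ <;> rfl
        · simp [hz]
      refine ⟨l'.map φ ++ r'.map φ, ?_, ?_, fun σ' =>
        ⟨Function.update σ' y (xor (xor (σ' x) ε) (!δ)), ?_⟩⟩
      · rw [← List.map_append]
        have hsub : (l' ++ r').Nodup := hL.sublist (by simp)
        have hx : (x, ε) ∉ l' ++ r' ∧ (y, δ) ∉ l' ++ r' := by
          obtain ⟨h₁, h₂⟩ := List.nodup_cons.mp (List.nodup_middle.mp hL)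
          exact ⟨fun h => h₁ (((List.sublist_cons_self _ _).append_left l').subset h),
            (List.nodup_cons.mp (List.nodup_middle.mp h₂)).1⟩
        refine List.Nodup.map_on ?_ hsub
        rintro ⟨z, γ⟩ hz ⟨z', γ'⟩ hz' heq
        have h1 : (z, γ) ≠ (x, ε) := fun h => hx.1 (h ▸ hz)
        have h2 : (z, γ) ≠ (y, δ) := fun h => hx.2 (h ▸ hz)
        have h1' : (z', γ') ≠ (x, ε) := fun h => hx.1 (h ▸ hz')
        have h2' : (z', γ') ≠ (y, δ) := fun h => hx.2 (h ▸ hz')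
        simp only [φ] at heq
        clear hz hz' hx hsub hL key hφ φ hr hu
        split_ifs at heq <;> cases ε <;> cases δ <;> cases γ <;> cases γ' <;> simp_all
      · simp at hr
        simp [hl, hr]
      · rw [List.map_append (l₁ := l'.map φ)]
        refine key _ _ _ ?_ ?_ ?_
        · simp only [strandValue, Function.update_self, Function.update_of_ne hxy]
          cases σ' x <;> cases ε <;> cases δ <;> rfl
        · rw [List.map_map]
          exact List.map_congr_left fun c _ => hφ σ' c
        · rw [List.map_map]
          exact List.map_congr_left fun c _ => hφ σ' c
  | cross s a b l r =>
    obtain ⟨l', r', rfl, hl, hr⟩ := exists_append_of_length (hu.trans List.length_append)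
    obtain _ | ⟨c, _ | ⟨d, r'⟩⟩ := r'
    · simp at hr
    · simp at hr
    refine ⟨l' ++ d :: c :: r', ?_, ?_, fun σ => ⟨σ, ?_⟩⟩
    · refine (List.Perm.nodup_iff ?_).mp hL
      exact (List.Perm.swap d c r').append_left l'
    · simp at hr
      simp [hl, hr]
    · have := (Passes.cross s (strandValue σ c) (strandValue σ d) (l'.map (strandValue σ))
        (r'.map (strandValue σ))).admits
      simpa [Event.forget, Event.twist, hl] using this
  | axisMin d r =>
    obtain ⟨x, hx⟩ := exists_fst_fresh L
    exact ⟨(x, false) :: L, List.nodup_cons.mpr ⟨hx false, hL⟩, by simp [hu], fun σ =>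
      ⟨σ, (Passes.axisMin _ _).admits⟩⟩
  | axisMax d r =>
    obtain _ | ⟨c, L⟩ := L
    · simp at hu
    exact ⟨L, (List.nodup_cons.mp hL).2, by simpa using hu, fun σ =>
      ⟨σ, (Passes.axisMax _ _).admits⟩⟩
  | axisCross s a r =>
    obtain _ | ⟨c, L⟩ := L
    · simp at hu
    exact ⟨c :: L, hL, by simpa using hu, fun σ =>
      ⟨σ, admits_axisTwists_of_even _ _ _ (Int.natAbs_even.mpr hh)⟩⟩

theorem Word.twist_cons {α : Type} (h : ℤ) (e : Event α) (w : Word α) :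
    Word.twist h (e :: w) = e.twist h ++ Word.twist h w := rfl

theorem Word.twist_append {α : Type} (h : ℤ) (w z : Word α) :
    Word.twist h (w ++ z) = Word.twist h w ++ Word.twist h z :=
  List.flatMap_append

theorem Runs.exists_strands {h : ℤ} (hh : Even h) {w : Word Bool} {u v : List Bool}
    (hw : Runs w u v) {L : List (ℕ × Bool)} (hL : L.Nodup) (hu : L.length = u.length) :
    ∃ L' : List (ℕ × Bool), L'.Nodup ∧ L'.length = v.length ∧ ∀ σ', ∃ σ,
      Word.Admits (Word.twist h w.forget) (L.map (strandValue σ)) (L'.map (strandValue σ')) := by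
  induction hw generalizing L with
  | nil u => exact ⟨L, hL, hu, fun σ => ⟨σ, Word.admits_nil.mpr rfl⟩⟩
  | cons he _ ih =>
    obtain ⟨L₁, hL₁, hu₁, h₁⟩ := he.exists_strands hh hL hu
    obtain ⟨L₂, hL₂, hu₂, h₂⟩ := ih hL₁ hu₁
    refine ⟨L₂, hL₂, hu₂, fun σ₂ => ?_⟩
    obtain ⟨σ₁, k₁⟩ := h₂ σ₂
    obtain ⟨σ, k⟩ := h₁ σ₁
    exact ⟨σ, k.append k₁⟩

theorem Word.forget_twist (h : ℤ) (w : Word Bool) :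
    (Word.twist h w).forget = Word.twist h w.forget := by
  induction w with
  | nil => rfl
  | cons e w ih =>
    have he : Word.forget (e.twist h) = e.forget.twist h := by
      rcases e with ⟨_ | _ | _, _⟩ | _ | _ | _ <;> simp [Event.twist, Event.forget, Word.forget]
    rw [Word.twist_cons, Word.forget_append, he, ih]
    rfl

theorem exists_isTwist (h : ℤ) (D : SymDiagram) : ∃ E, IsTwist h D E := by
  rcases Int.even_or_odd h with hh | hh
  · obtain ⟨L, -, hL, H⟩ := D.closed.exists_strands hh List.nodup_nil rfl
    obtain rfl := List.length_eq_zero_iff.mp hL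
    obtain ⟨_, w, hw, hr⟩ := H fun _ => true
    exact ⟨⟨w, hr⟩, hw⟩
  · exact ⟨D.oddTwist h hh, Word.forget_twist h D.word⟩

/-! ### Words with at most one orientation for given boundaries -/

/-- First no event creates strands, and then no event removes strands. -/
def Word.Rigid (w : Word Unit) : Prop :=
  ∃ w₁ w₂, w = w₁ ++ w₂ ∧ (∀ e ∈ w₁, e.out ≤ e.inn) ∧ ∀ e ∈ w₂, e.inn ≤ e.out

theorem Passes.eq_of_out_le {e e' : Event Bool} {u v v' : List Bool} (h : Passes e u v)
    (h' : Passes e' u v') (hf : e.forget = e'.forget) (ho : e.forget.out ≤ e.forget.inn) :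
    e = e' ∧ v = v' := by
  rcases e with ⟨d | d | s, i⟩ | d | d | s <;> rcases e' with ⟨d' | d' | s', i'⟩ | d' | d' | s' <;>
    simp [Event.forget, Event.out, Event.inn] at hf ho
  · subst hf
    obtain ⟨l, r, rfl, rfl, rfl⟩ := Passes.off_cap_iff.mp h
    obtain ⟨l', r', hl, he, rfl⟩ := Passes.off_cap_iff.mp h'
    obtain ⟨rfl, h2⟩ := List.append_inj he hl.symm
    simp_all
  · obtain ⟨rfl, rfl⟩ := hf
    obtain ⟨l, r, a, b, rfl, rfl, rfl⟩ := Passes.off_cross_iff.mp h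
    obtain ⟨l', r', a', b', hl, he, rfl⟩ := Passes.off_cross_iff.mp h'
    obtain ⟨rfl, h2⟩ := List.append_inj he hl.symm
    simp_all
  · have h1 := Passes.on_max_iff.mp h
    have h2 := Passes.on_max_iff.mp h'
    simp_all
  · subst hf
    obtain ⟨a, r, rfl, rfl⟩ := Passes.on_cross_iff.mp h
    obtain ⟨a', r', he, rfl⟩ := Passes.on_cross_iff.mp h'
    simp_all

theorem Passes.eq_of_inn_le {e e' : Event Bool} {u u' v : List Bool} (h : Passes e u v)
    (h' : Passes e' u' v) (hf : e.forget = e'.forget) (ho : e.forget.inn ≤ e.forget.out) :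
    e = e' ∧ u = u' := by
  rcases e with ⟨d | d | s, i⟩ | d | d | s <;> rcases e' with ⟨d' | d' | s', i'⟩ | d' | d' | s' <;>
    simp [Event.forget, Event.out, Event.inn] at hf ho
  · subst hf
    obtain ⟨l, r, rfl, rfl, rfl⟩ := Passes.off_cup_iff.mp h
    obtain ⟨l', r', hl, rfl, he⟩ := Passes.off_cup_iff.mp h'
    obtain ⟨rfl, h2⟩ := List.append_inj he hl.symm
    simp_all
  · obtain ⟨rfl, rfl⟩ := hf
    obtain ⟨l, r, a, b, rfl, rfl, rfl⟩ := Passes.off_cross_iff.mp h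
    obtain ⟨l', r', a', b', hl, rfl, he⟩ := Passes.off_cross_iff.mp h'
    obtain ⟨rfl, h2⟩ := List.append_inj he hl.symm
    simp_all
  · have h1 := Passes.on_min_iff.mp h
    have h2 := Passes.on_min_iff.mp h'
    simp_all
  · subst hf
    obtain ⟨a, r, rfl, rfl⟩ := Passes.on_cross_iff.mp h
    obtain ⟨a', r', rfl, he⟩ := Passes.on_cross_iff.mp h'
    simp_all

theorem Runs.eq_of_out_le {w w' : Word Bool} {u v v' : List Bool} (h : Runs w u v)
    (h' : Runs w' u v') (hf : w.forget = w'.forget) (ho : ∀ e ∈ w.forget, e.out ≤ e.inn) :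
    w = w' ∧ v = v' := by
  induction h generalizing w' with
  | nil u =>
    obtain rfl : w' = [] := by simpa [Word.forget, eq_comm] using hf
    exact ⟨rfl, Runs.nil_iff.mp h'⟩
  | @cons e w u t v he _ ih =>
    obtain _ | ⟨e', w'⟩ := w'
    · simp [Word.forget] at hf
    obtain ⟨t', he', hr'⟩ := Runs.cons_iff.mp h'
    obtain ⟨hf₁, hf₂⟩ := List.cons.inj hf
    obtain ⟨rfl, rfl⟩ := he.eq_of_out_le he' hf₁ (ho _ (by simp [Word.forget]))
    obtain ⟨rfl, rfl⟩ := ih hr' hf₂ fun e he => ho e (List.mem_cons_of_mem _ he)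
    exact ⟨rfl, rfl⟩

theorem Runs.eq_of_inn_le {w w' : Word Bool} {u u' v : List Bool} (h : Runs w u v)
    (h' : Runs w' u' v) (hf : w.forget = w'.forget) (ho : ∀ e ∈ w.forget, e.inn ≤ e.out) :
    w = w' ∧ u = u' := by
  induction h generalizing w' u' with
  | nil u =>
    obtain rfl : w' = [] := by simpa [Word.forget, eq_comm] using hf
    exact ⟨rfl, (Runs.nil_iff.mp h').symm⟩
  | @cons e w u t v he _ ih =>
    obtain _ | ⟨e', w'⟩ := w'
    · simp [Word.forget] at hf
    obtain ⟨t', he', hr'⟩ := Runs.cons_iff.mp h'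
    obtain ⟨hf₁, hf₂⟩ := List.cons.inj hf
    obtain ⟨rfl, rfl⟩ := ih hr' hf₂ fun e he => ho e (List.mem_cons_of_mem _ he)
    obtain ⟨rfl, rfl⟩ := he.eq_of_inn_le he' hf₁ (ho _ (by simp [Word.forget]))
    exact ⟨rfl, rfl⟩

/-- In the first part every orientation is determined from below, in the second from above. -/
theorem Runs.eq_of_rigid {w w' : Word Bool} {u v : List Bool} (h : Runs w u v)
    (h' : Runs w' u v) (hf : w.forget = w'.forget) (hw : w.forget.Rigid) : w = w' := by
  obtain ⟨a, b, hab, ha, hb⟩ := hw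
  obtain ⟨a₁, b₁, rfl, rfl, rfl⟩ := Word.forget_eq_append hab
  obtain ⟨a₂, b₂, rfl, ha₂, hb₂⟩ := Word.forget_eq_append (hf.symm.trans hab)
  obtain ⟨t₁, r₁, s₁⟩ := Runs.append_iff.mp h
  obtain ⟨t₂, r₂, s₂⟩ := Runs.append_iff.mp h'
  rw [(r₁.eq_of_out_le r₂ ha₂.symm ha).1, (s₁.eq_of_inn_le s₂ hb₂.symm hb).1]

theorem Event.eq_on_cross_of_mem_twist {h : ℤ} {e f : Event Unit} (hf : f ∈ e.twist h) :
    f = e ∨ ∃ s, f = .on (.cross s) := by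
  rcases e with ⟨_ | _ | _, _⟩ | _ | _ | _ <;> simp_all [Event.twist]

theorem Word.Rigid.twist {w : Word Unit} (hw : w.Rigid) (h : ℤ) : (Word.twist h w).Rigid := by
  obtain ⟨w₁, w₂, rfl, h₁, h₂⟩ := hw
  refine ⟨_, _, Word.twist_append h w₁ w₂, ?_, ?_⟩ <;>
  · intro f hf
    obtain ⟨e, he, hf⟩ := List.mem_flatMap.mp hf
    obtain rfl | ⟨s, rfl⟩ := Event.eq_on_cross_of_mem_twist hf
    · first | exact h₁ _ he | exact h₂ _ he
    · exact le_rfl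

theorem PlanarIsotopy.rigid {a b : Word Unit} (h : PlanarIsotopy a b) : a.Rigid ∨ b.Rigid := by
  cases h with
  | exchange e g k =>
    -- Only when `e` creates strands and `g` removes them is the left side not rigid; then on the
    -- right side the removal comes first.
    by_cases hg : (Event.off g 0).inn ≤ (Event.off g 0).out
    · by_cases he : e.out ≤ e.inn
      · refine .inl ⟨[e], [_], rfl, by simpa using he, ?_⟩
        rcases g with _ | _ | _ <;> simp_all [Event.inn, Event.out]
      · refine .inl ⟨[], _, rfl, by simp, ?_⟩
        rcases g with _ | _ | _ <;> simp_all [Event.inn, Event.out] <;> omega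
    · by_cases he : e.out ≤ e.inn
      · refine .inl ⟨_, [], by simp; rfl, ?_, by simp⟩
        rcases g with _ | _ | _ <;> simp_all [Event.inn, Event.out]
      · refine .inr ⟨[_], [e], rfl, ?_, by simp; omega⟩
        rcases g with _ | _ | _ <;> simp_all [Event.inn, Event.out]
  | zigzag_left i => exact .inr ⟨[], [], rfl, by simp, by simp⟩
  | zigzag_right i => exact .inr ⟨[], [], rfl, by simp, by simp⟩
  | slide_cup i s => exact .inl ⟨[], _, rfl, by simp, by simp [Event.inn, Event.out]⟩
  | slide_cap i s =>
    exact .inl ⟨_, [], (List.append_nil _).symm, by simp [Event.inn, Event.out], by simp⟩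
  | fork_max => exact .inl ⟨_, [], (List.append_nil _).symm, by simp [Event.inn, Event.out], by simp⟩
  | fork_min => exact .inl ⟨[], _, rfl, by simp, by simp [Event.inn, Event.out]⟩

theorem OffAxisMove.rigid {a b : Word Unit} (h : OffAxisMove a b) : a.Rigid ∨ b.Rigid := by
  cases h with
  | r1_right i s => exact .inr ⟨[], [], rfl, by simp, by simp⟩
  | r1_left i s => exact .inr ⟨[], [], rfl, by simp, by simp⟩
  | r2 i s => exact .inr ⟨[], [], rfl, by simp, by simp⟩
  | r3 i a b c h => exact .inl ⟨[], _, rfl, by simp, by simp [Event.inn, Event.out]⟩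

theorem AxisMove.rigid {a b : Word Unit} (h : AxisMove a b) : a.Rigid ∨ b.Rigid := by
  cases h with
  | s2h s =>
    exact .inr ⟨[_], [_], rfl, by simp [Event.inn, Event.out], by simp [Event.inn, Event.out]⟩
  | s2 s n => exact .inr ⟨[], _, rfl, by simp, by simp [Event.inn, Event.out]⟩
  | s3_min s n => exact .inl ⟨[], _, rfl, by simp, by simp [Event.inn, Event.out]⟩
  | s3_max s n =>
    exact .inl ⟨_, [], (List.append_nil _).symm, by simp [Event.inn, Event.out], by simp⟩
  | s4 s m n =>
    exact .inr ⟨[_, _], [_, _], rfl, by simp [Event.inn, Event.out], by simp [Event.inn, Event.out]⟩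

theorem S1Move.rigid {a b : Word Unit} (h : S1Move a b) : a.Rigid ∨ b.Rigid := by
  cases h with
  | above n =>
    exact .inl ⟨_, [], (List.append_nil _).symm, by simp [Event.inn, Event.out], by simp⟩
  | below n => exact .inl ⟨[], _, rfl, by simp, by simp [Event.inn, Event.out]⟩

theorem S2vMove.rigid {a b : Word Unit} (h : S2vMove a b) : a.Rigid ∨ b.Rigid := by
  cases h with
  | mk n => exact .inr ⟨[], [], rfl, by simp, by simp⟩

/-! ### The twisted form of every move -/

/-- Extracts the bounds on the number of strands from the mere existence of an oriented form; moves
with an empty side need them. -/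
theorem Word.Admits.exists_of_cons {e : Event Unit} {w : Word Unit} {u v : List Bool}
    (h : Word.Admits (e :: w) u v) :
    e.pos + e.inn ≤ u.length ∧ ∃ t, t.length = e.top u.length ∧ w.Admits t v := by
  obtain ⟨t, ⟨e', rfl, he⟩, hw⟩ := Word.admits_cons.mp h
  exact ⟨he.pos_add_inn_le, t, he.length_eq, hw⟩

theorem Word.top_twist (h : ℤ) (w : Word Unit) (n : ℕ) :
    Word.top (Word.twist h w) n = Word.top w n := by
  induction w generalizing n with
  | nil => rfl
  | cons e w ih =>
    have he : Word.top (e.twist h) n = e.top n := by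
      rcases e with ⟨_ | _ | _, _⟩ | _ | _ | _ <;>
        simp [Event.twist, Word.top, Event.top, Word.top_replicate_axisCross]
    rw [Word.twist_cons, Word.top_append, he, ih]
    rfl

/-- Words related by `M` that occur with the same boundary in diagrams can be replaced by each
other after all crossings on the axis have been replaced by `|h|` crossings. -/
def TwistsTo (R : SymDiagram → SymDiagram → Prop) (h : ℤ) (M : Word Unit → Word Unit → Prop) :
    Prop :=
  ∀ ⦃a b : Word Unit⦄ ⦃u v : List Bool⦄, M a b → a.Admits u v → b.Admits u v →
    Conv R u.length (Word.twist h a) (Word.twist h b)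

namespace IsMoveRelation

variable (hR : IsMoveRelation R) (h : ℤ)
include hR

theorem twist_planar : TwistsTo R h PlanarIsotopy := by
  intro a b u v hab ha hb
  cases hab with
  | exchange e g k =>
    rcases e with ⟨f, i⟩ | _ | _ | s
    · exact hR.exchange (.off f i) g k _
    · exact hR.exchange (.on (.min _)) g k _
    · exact hR.exchange (.on (.max _)) g k _
    · simpa [Word.twist, Event.twist, Event.pos, Event.out, Event.inn, Nat.add_comm] using
        hR.axisTwists_comm (if 0 ≤ h then s else !s) h.natAbs g k u.length
  | zigzag_left i =>
    exact hR.planar (.zigzag_left i) (.zigzag_left i _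
      (by have := ha.exists_of_cons.2.choose_spec.2.exists_of_cons.1
          rw [ha.exists_of_cons.2.choose_spec.1] at this
          simp [Event.pos, Event.inn, Event.top] at this; omega))
  | zigzag_right i =>
    exact hR.planar (.zigzag_right i) (.zigzag_right i _ ha.exists_of_cons.1)
  | slide_cup i s => exact hR.planar (.slide_cup i s) (.slide_cup i s _)
  | slide_cap i s => exact hR.planar (.slide_cap i s) (.slide_cap i s _)
  | fork_max => exact hR.planar .fork_max (.fork_max _)
  | fork_min => exact hR.planar .fork_min (.fork_min _)

theorem twist_offAxis : TwistsTo R h OffAxisMove := by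
  intro a b u v hab ha hb
  cases hab with
  | r1_right i s => exact hR.offAxis (.r1_right i s) (.r1_right i s _ ha.exists_of_cons.1)
  | r1_left i s =>
    exact hR.offAxis (.r1_left i s) (.r1_left i s _
      (by have := ha.exists_of_cons.2.choose_spec.2.exists_of_cons.1
          rw [ha.exists_of_cons.2.choose_spec.1] at this
          simp [Event.pos, Event.inn, Event.top] at this; omega))
  | r2 i s => exact hR.offAxis (.r2 i s) (.r2 i s _ ha.exists_of_cons.1)
  | r3 i a b c h' => exact hR.offAxis (.r3 i a b c h') (.r3 i a b c _)

theorem twist_onAxis : TwistsTo R h AxisMove := by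
  intro a b u v hab ha hb
  cases hab with
  | s2h s => exact hR.onAxis (.s2h s) _
  | s2 s n =>
    simpa [Word.twist, Event.twist] using
      hR.turn_axisTwists s (if 0 ≤ h then n else !n) h.natAbs _ hb.exists_of_cons.1
  | s3_min s n =>
    simpa [Word.twist, Event.twist] using
      hR.min_crs_axisTwists s (if 0 ≤ h then n else !n) h.natAbs u.length
  | s3_max s n =>
    simpa [Word.twist, Event.twist] using
      hR.axisTwists_crs_max s (if 0 ≤ h then n else !n) h.natAbs u.length
  | s4 s m n =>
    have hn : 2 ≤ u.length := by
      obtain ⟨t, ht, h'⟩ := hb.exists_of_cons.2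
      simpa [ht, Event.pos, Event.inn, Event.top] using h'.exists_of_cons.1
    -- Both stacks have the same height, so either both are empty or neither is.
    have key : ∀ k, Swaps R s (axisTwists (if 0 ≤ h then n else !n) k)
        (axisTwists (if 0 ≤ h then m else !m) k) := by
      rintro (_ | k)
      · exact hR.swaps_nil s
      · exact hR.swaps_axisTwists s _ _ k k
    simpa [Word.twist, Event.twist] using key h.natAbs _ hn

theorem twist_s1 : TwistsTo R h S1Move := by
  intro a b u v hab ha hb
  cases hab with
  | above n =>
    simpa [Word.twist, Event.twist] using
      hR.axisTwists_max (if 0 ≤ h then n else !n) h.natAbs u.length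
  | below n =>
    simpa [Word.twist, Event.twist] using
      hR.min_axisTwists (if 0 ≤ h then n else !n) h.natAbs u.length

theorem twist_s2v (hv : ∀ {D E : SymDiagram}, Local S2vMove D E → R D E) :
    TwistsTo R h S2vMove := by
  intro a b u v hab ha hb
  cases hab with
  | mk n =>
    have := hR.axisTwists_cancel hv (if 0 ≤ h then n else !n) h.natAbs u.length ha.exists_of_cons.1
    by_cases hh : 0 ≤ h <;> simpa [Word.twist, Event.twist, hh] using this

end IsMoveRelation

/-! ### Twisting a step -/

/-- `E` is reached from every orientation of `D(h)` by a suitable orientation of `E(h)`. -/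
def TwistLifts (R : SymDiagram → SymDiagram → Prop) (h : ℤ) (D E : SymDiagram) : Prop :=
  ∀ D₁, IsTwist h D D₁ → ∃ E₁, IsTwist h E E₁ ∧ R D₁ E₁

theorem TwistsTo.flip {h : ℤ} {M : Word Unit → Word Unit → Prop} (hM : TwistsTo R h M) :
    TwistsTo R h fun a b => M b a :=
  fun _ _ _ _ hab ha hb => (hM hab hb ha).symm

theorem TwistsTo.lifts {h : ℤ} {M : Word Unit → Word Unit → Prop} (hM : TwistsTo R h M)
    {D E : SymDiagram} (hDE : Local M D E) : TwistLifts R h D E := by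
  obtain ⟨p, a, b, q, u, v, hD, hE, hab, hp, ha, hb, hq⟩ := hDE
  rintro ⟨w, hw⟩ hD₁
  simp only [IsTwist, hD, Word.forget_append, Word.twist_append] at hD₁
  obtain ⟨w', q', rfl, hw', hq'⟩ := Word.forget_eq_append hD₁
  obtain ⟨p', a', rfl, hp', ha'⟩ := Word.forget_eq_append hw'
  obtain ⟨t, hr, hqr⟩ := Runs.append_iff.mp hw
  obtain ⟨s, hpr, har⟩ := Runs.append_iff.mp hr
  -- The orientation of `D₁` at the cut may differ from `u`. Only the number of strands is known to
  -- agree, which is why `Transfers` admits every boundary of a given length.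
  have hs : s.length = u.length := by
    rw [hpr.length_eq, hp.length_eq, hp', Word.top_twist]
  obtain ⟨b', hbr, hb', H⟩ := (hM hab ⟨a, rfl, ha⟩ ⟨b, rfl, hb⟩).1 s t a' hs ha' har
  exact ⟨⟨p' ++ b' ++ q', (hpr.append hbr).append hqr⟩,
    by simp [IsTwist, Word.forget_append, Word.twist_append, *], H p' q' hpr hqr⟩

/-- The transfer only yields some orientation `b'` of the twisted word. Rigidity identifies it with
the inherited one, as both have the boundary `u`, `v`. -/
theorem TwistsTo.oddTwist {h : ℤ} (hh : Odd h) {M : Word Unit → Word Unit → Prop}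
    (hM : TwistsTo R h M) {D E : SymDiagram} {p a b q : Word Bool} {u v : List Bool}
    (hD : D.word = p ++ a ++ q) (hE : E.word = p ++ b ++ q) (hab : M a.forget b.forget)
    (hp : Runs p [] u) (ha : Runs a u v) (hb : Runs b u v) (hq : Runs q v [])
    (hrigid : b.forget.Rigid) : R (D.oddTwist h hh) (E.oddTwist h hh) := by
  obtain ⟨b', hbr, hb', H⟩ := (hM hab ⟨a, rfl, ha⟩ ⟨b, rfl, hb⟩).1 u v (Word.twist h a) rfl
    (Word.forget_twist h a) (ha.twist hh)
  obtain rfl : Word.twist h b = b' :=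
    (hb.twist hh).eq_of_rigid hbr (by rw [hb', Word.forget_twist])
      (by rw [Word.forget_twist]; exact hrigid.twist h)
  simpa only [SymDiagram.oddTwist, hD, hE, Word.twist_append] using
    H (Word.twist h p) (Word.twist h q) (hp.twist hh) (hq.twist hh)

theorem IsMoveRelation.twistsRelated_of_local (hR : IsMoveRelation R) {h : ℤ}
    {M : Word Unit → Word Unit → Prop} (hM : TwistsTo R h M)
    (hrigid : ∀ {a b}, M a b → a.Rigid ∨ b.Rigid) {D E : SymDiagram} (hDE : Local M D E) :
    TwistsRelated R h D E := by
  refine ⟨exists_isTwist h D, exists_isTwist h E, hM.lifts hDE, fun E₁ hE₁ => ?_, fun hh => ?_⟩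
  · obtain ⟨D₁, hD₁, hR₁⟩ := hM.flip.lifts hDE.symm E₁ hE₁
    exact ⟨D₁, hD₁, hR.equivalence.symm hR₁⟩
  · obtain ⟨p, a, b, q, u, v, hD, hE, hab, hp, ha, hb, hq⟩ := hDE
    -- The move is applied in the direction that ends at its rigid side.
    rcases hrigid hab with h' | h'
    · exact hR.equivalence.symm (hM.flip.oddTwist hh hE hD hab hp hb ha hq h')
    · exact hM.oddTwist hh hD hE hab hp ha hb hq h'

/-! ### The half-turn -/

theorem Passes.halfTurn {e : Event Bool} {u v : List Bool} (h : Passes e u v) :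
    Passes e.halfTurn v u := by
  cases h with
  | cup d l r => exact .cap d l r
  | cap d l r => exact .cup d l r
  | cross s a b l r => exact .cross (!s) b a l r
  | axisMin d => exact .axisMax d _
  | axisMax d => exact .axisMin d _
  | axisCross s a r => simpa [Event.halfTurn] using Passes.axisCross s (!a) r

theorem Runs.halfTurn {w : Word Bool} {u v : List Bool} (h : Runs w u v) :
    Runs (w.map Event.halfTurn).reverse v u := by
  induction h with
  | nil u => exact .nil u
  | cons he _ ih =>
    simpa using ih.append (.cons he.halfTurn (.nil _))

/-- The half-turn of a diagram. -/
def SymDiagram.halfTurn (D : SymDiagram) : SymDiagram where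
  word := (D.word.map Event.halfTurn).reverse
  closed := D.closed.halfTurn

theorem Event.halfTurn_halfTurn (e : Event Bool) : e.halfTurn.halfTurn = e := by
  rcases e with ⟨_ | _ | _, _⟩ | _ | _ | _ <;> simp [Event.halfTurn]

theorem IsHalfTurn.symm {D E : SymDiagram} (h : IsHalfTurn D E) : IsHalfTurn E D := by
  have : Event.halfTurn ∘ Event.halfTurn = id := funext Event.halfTurn_halfTurn
  simp [IsHalfTurn, show E.word = _ from h, this]

theorem Event.forget_halfTurn_congr {e f : Event Bool} (h : e.forget = f.forget) :
    e.halfTurn.forget = f.halfTurn.forget := by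
  rcases e with ⟨_ | _ | _, _⟩ | _ | _ | _ <;> rcases f with ⟨_ | _ | _, _⟩ | _ | _ | _ <;>
    simp_all [Event.forget, Event.halfTurn]

theorem Word.forget_halfTurn_congr {w z : Word Bool} (h : w.forget = z.forget) :
    Word.forget (w.map Event.halfTurn).reverse = Word.forget (z.map Event.halfTurn).reverse := by
  induction w generalizing z with
  | nil =>
    obtain rfl : z = [] := by simpa [Word.forget, eq_comm] using h
    rfl
  | cons e w ih =>
    obtain _ | ⟨f, z⟩ := z
    · simp [Word.forget] at h
    obtain ⟨h₁, h₂⟩ := List.cons.inj h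
    simp only [List.map_cons, List.reverse_cons, Word.forget_append, ih h₂]
    simp [Word.forget, Event.forget_halfTurn_congr h₁]

/-- A stack is a constant list of crossings that the half-turn fixes, so reversing it has no effect.
-/
theorem Word.twist_halfTurn (h : ℤ) (w : Word Bool) :
    Word.twist h (w.map Event.halfTurn).reverse =
      ((Word.twist h w).map Event.halfTurn).reverse := by
  induction w with
  | nil => rfl
  | cons e w ih =>
    have he : Word.twist h [e.halfTurn] = ((e.twist h).map Event.halfTurn).reverse := by
      rcases e with ⟨_ | _ | _, _⟩ | _ | _ | _ <;> simp [Word.twist, Event.twist, Event.halfTurn]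
    simp only [List.map_cons, List.reverse_cons, Word.twist_append, ih, he, Word.twist_cons,
      List.map_append, List.reverse_append]

namespace IsMoveRelation

variable (hR : IsMoveRelation R) {h : ℤ}
include hR

theorem twistLifts_of_isHalfTurn {D E : SymDiagram} (hDE : IsHalfTurn D E) :
    TwistLifts R h D E := by
  intro D₁ hD₁
  refine ⟨D₁.halfTurn, ?_, hR.step (.inr (.inl rfl))⟩
  -- For even `h` the labels of `Word.twist h D.word` need not form an orientation; the word serves
  -- only as a labelled representative to which `Event.halfTurn` applies.
  rw [IsTwist, ← Word.forget_twist] at hD₁ ⊢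
  rw [show E.word = _ from hDE, Word.twist_halfTurn]
  exact Word.forget_halfTurn_congr hD₁

theorem twistsRelated_of_isHalfTurn {D E : SymDiagram} (hDE : IsHalfTurn D E) :
    TwistsRelated R h D E := by
  refine ⟨exists_isTwist h D, exists_isTwist h E, hR.twistLifts_of_isHalfTurn hDE,
    fun E₁ hE₁ => ?_, fun hh => hR.step (.inr (.inl ?_))⟩
  · obtain ⟨D₁, hD₁, hR₁⟩ := hR.twistLifts_of_isHalfTurn hDE.symm E₁ hE₁
    exact ⟨D₁, hD₁, hR.equivalence.symm hR₁⟩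
  · simp only [IsHalfTurn, SymDiagram.oddTwist]
    rw [show E.word = _ from hDE, Word.twist_halfTurn]

/-! ### Sequences of steps -/

theorem twistsRelated_of_symStep {D E : SymDiagram} (hDE : SymStep D E) :
    TwistsRelated R h D E := by
  obtain hDE | hDE | hDE | hDE | hDE := hDE
  · exact hR.twistsRelated_of_local (hR.twist_planar h) PlanarIsotopy.rigid hDE
  · exact hR.twistsRelated_of_isHalfTurn hDE
  · exact hR.twistsRelated_of_local (hR.twist_offAxis h) OffAxisMove.rigid hDE
  · exact hR.twistsRelated_of_local (hR.twist_onAxis h) AxisMove.rigid hDE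
  · exact hR.twistsRelated_of_local (hR.twist_s1 h) S1Move.rigid hDE

theorem twistsRelated_of_eqvGen {r : SymDiagram → SymDiagram → Prop}
    (hr : ∀ D E, r D E → TwistsRelated R h D E) {D E : SymDiagram}
    (hDE : Relation.EqvGen r D E) : TwistsRelated R h D E := by
  induction hDE with
  | rel D E hDE => exact hr D E hDE
  | refl D =>
    have := hR.equivalence.refl
    exact ⟨exists_isTwist h D, exists_isTwist h D, fun D₁ hD₁ => ⟨D₁, hD₁, this _⟩,
      fun D₁ hD₁ => ⟨D₁, hD₁, this _⟩, fun _ => this _⟩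
  | symm D E _ ih =>
    obtain ⟨hD, hE, h₁, h₂, h₃⟩ := ih
    refine ⟨hE, hD, fun E₁ hE₁ => ?_, fun D₁ hD₁ => ?_, fun hh => hR.equivalence.symm (h₃ hh)⟩
    · obtain ⟨D₁, hD₁, hR₁⟩ := h₂ E₁ hE₁
      exact ⟨D₁, hD₁, hR.equivalence.symm hR₁⟩
    · obtain ⟨E₁, hE₁, hR₁⟩ := h₁ D₁ hD₁
      exact ⟨E₁, hE₁, hR.equivalence.symm hR₁⟩
  | trans D E F _ _ ih ih' =>
    obtain ⟨hD, -, h₁, h₂, h₃⟩ := ih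
    obtain ⟨-, hF, h₁', h₂', h₃'⟩ := ih'
    refine ⟨hD, hF, fun D₁ hD₁ => ?_, fun F₁ hF₁ => ?_, fun hh =>
      hR.equivalence.trans (h₃ hh) (h₃' hh)⟩
    · obtain ⟨E₁, hE₁, hR₁⟩ := h₁ D₁ hD₁
      obtain ⟨F₁, hF₁, hR₁'⟩ := h₁' E₁ hE₁
      exact ⟨F₁, hF₁, hR.equivalence.trans hR₁ hR₁'⟩
    · obtain ⟨E₁, hE₁, hR₁⟩ := h₂' F₁ hF₁
      obtain ⟨D₁, hD₁, hR₁'⟩ := h₂ E₁ hE₁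
      exact ⟨D₁, hD₁, hR.equivalence.trans hR₁' hR₁⟩

end IsMoveRelation

theorem isMoveRelation_symEquiv : IsMoveRelation SymEquiv :=
  ⟨Relation.EqvGen.is_equivalence _, fun h => .rel _ _ h⟩

theorem isMoveRelation_weakSymEquiv : IsMoveRelation WeakSymEquiv :=
  ⟨Relation.EqvGen.is_equivalence _, fun h => .rel _ _ (.inl h)⟩

end SymUnion

theorem theorem1p1 (D D' : SymUnion.SymDiagram) :
    (SymUnion.SymEquiv D D' →
      ∀ h : ℤ, SymUnion.TwistsRelated SymUnion.SymEquiv h D D') ∧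
    (SymUnion.WeakSymEquiv D D' →
      ∀ h : ℤ, SymUnion.TwistsRelated SymUnion.WeakSymEquiv h D D') := by
  have hS := SymUnion.isMoveRelation_symEquiv
  have hW := SymUnion.isMoveRelation_weakSymEquiv
  refine ⟨fun hD h => hS.twistsRelated_of_eqvGen (fun _ _ => hS.twistsRelated_of_symStep) hD,
    fun hD h => hW.twistsRelated_of_eqvGen ?_ hD⟩
  rintro D E (hDE | hDE)
  · exact hW.twistsRelated_of_symStep hDE
  · exact hW.twistsRelated_of_local (hW.twist_s2v h fun hv => .rel _ _ (.inr hv))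
      SymUnion.S2vMove.rigid hDE
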